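/- **Setting.** $P$ is a finite set of node identifiers, $n=|P|$, and $N=C\cup B\subseteq P$ is the set of existing nodes, where $C$ are the correct and $B$ the Byzantine ones, $C\cap B=\emptyset$, $|B|\le f$. $G=(N,E)$ is the (undirected) communication graph, in which any two distinct correct nodes are joined by $2f+1$ vertex-disjoint paths. $p_s\ne p_r$ are two correct nodes, the sender and the receiver. Every link is a FIFO channel in each direction. Sending appends to the channel. Executions are considered in which at most $capacity$ messages are in transit, in each direction, on a link between correct nodes. A step of a correct node is either a *timer step* (one iteration of its loop) or the receipt of the oldest message (if any) from one neighbor. A Byzantine node may at any time remove the oldest messages of its incoming channels and send arbitrary messages to its neighbors. An execution is *fair* if every correct node takes a timer step infinitely often and executes the receipt from each of its neighbors infinitely often. An *asynchronous round* is a minimal segment of the execution in which every correct node takes a timer step and executes the receipt from each of its neighbors at least once (rounds are counted one after the other). **Topology and paths.** Each correct node $p_i$ holds a fixed, legal discovered topology $T_i$: a set of directed edges between nodes of $N$ that agrees with $E$ on $C\times C$. The undirected edge $\{u,v\}$ is *approved* if both $(u,v)$ and $(v,u)$ are in $T_i$. The path set $Paths_i(d)$ that $p_i$ uses towards $d$ is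 computed in one of three ways: (a) all simple paths from $p_i$ to $d$ over approved edges; (b) the union, over all sets $F$ of $f$ identifiers, of some set of $f+1$ vertex-disjoint paths over approved edges that avoid $F$ (of $\emptyset$ if there is no such set); (c) some $2f+1$ vertex-disjoint paths over the edges that are reported in at least one direction; in this case it is also assumed that no two Byzantine nodes are neighbors and that each $T_i$ contains all edges $(u,v)\in E$ with $u\in C$. **Algorithm.** A message carries a source, a destination, the ordered list of visited nodes, an intended path, a label in $\mathbb Z/3$, a type (data or ack), and a payload. A correct node that receives a message from a neighbor appends that neighbor to the visited list. If it is not the destination it then forwards the message to the next node on the intended path. Let $\theta=capacity\cdot n+1$. A payload–label pair is *supported* if, for $f+1$ vertex-disjoint simple paths between $p_s$ and $p_r$, the last $\theta$ entries logged for that visited path all equal the pair. *Sender.* Its state consists of a current payload and label, a flag $Approved$, and a log of acknowledgments per visited path. In a timer step, if $Approved$ holds, it first clears its log, fetches the next payload (which the application always supplies), increments the label modulo 3 and resets $Approved$. Then, in every case, it sends the current payload and label, as data, over all its paths to $p_r$. On an acknowledgment of $p_r$ it logs the payload and label if the label is the current one, and sets $Approved$ if the received pair is supported. *Receiver.* Its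 state consists of a current label, a payload–label pair that it is acknowledging (or none), and a log of data messages per visited path. On a data message of $p_s$ it logs payload and label. If that pair is supported, the receiver delivers the payload to the application (this is *confirming* the message) unless the label equals the current label. In both cases it then makes the label its current one, clears its log, and from then on acknowledges this pair. In a timer step it sends the acknowledgment, if any, over all its paths to $p_s$. **Legal executions and safe configurations.** A sending step of $p_s$ and a delivery step of $p_r$ *correspond* if they concern the same payload and no fetch step separates them (that is, equally many fetches have occurred in the execution up to each of them). An execution is *legal* if (1) for every step in which the sender sends $m$ there is a corresponding step in which the receiver delivers $m$, (2) for every step in which the receiver delivers $m$ there is an earlier corresponding step in which the sender sends $m$, and (3) at most one delivery occurs between two consecutive fetches. A configuration is *safe* if every fair execution that starts in it is legal. **Theorem (Self-stabilization).** There is a universal constant $K$ such that for every system as above and every fair execution $R$ that starts in an arbitrary configuration, the sender fetches for the fourth time within the first $K\cdot capacity\cdot n$ asynchronous rounds of $R$ (so within $O(n)$ rounds for constant capacity), and the configuration immediately before that fetch is safe. In particular, from the fourth fetched message on, the receiver delivers each message that the sender sends, exactly once and before the next fetch, and delivers nothing else. -/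

import Mathlib

namespace EndToEnd

/-! ## Paths -/

/-- `l = [u, …, v]` is a simple path from `u` to `v` in `G`. -/
def IsPath {P : Type*} (G : SimpleGraph P) (u v : P) (l : List P) : Prop :=
  l.Nodup ∧ l.IsChain G.Adj ∧ l.head? = some u ∧ l.getLast? = some v

/-- The nodes of a path other than its two end nodes. -/
def interior {P : Type*} (l : List P) : List P := l.tail.dropLast

/-- `S` consists of `k` paths from `u` to `v` in `G` that pairwise share no node except `u`, `v`. -/
def VertexDisjointPaths {P : Type*} (G : SimpleGraph P) (u v : P) (k : ℕ)
    (S : Finset (List P)) : Prop :=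
  S.card = k ∧ (∀ l ∈ S, IsPath G u v l) ∧
    ∀ l ∈ S, ∀ l' ∈ S, l ≠ l' → List.Disjoint (interior l) (interior l')

/-- The graph of the approved edges of a reported topology (reported in both directions). -/
def approvedGraph {P : Type*} (T : P → P → Prop) : SimpleGraph P where
  Adj u v := u ≠ v ∧ T u v ∧ T v u
  symm := ⟨fun _ _ h => ⟨h.1.symm, h.2.2, h.2.1⟩⟩
  loopless := ⟨fun _ h => h.1 rfl⟩

/-- The graph of the approved and the suspicious edges (reported in at least one direction). -/
def extendedGraph {P : Type*} (T : P → P → Prop) : SimpleGraph P where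
  Adj u v := u ≠ v ∧ (T u v ∨ T v u)
  symm := ⟨fun _ _ h => ⟨h.1.symm, h.2.symm⟩⟩
  loopless := ⟨fun _ h => h.1 rfl⟩

/-- The graph that remains of `G` when the nodes in `F` are removed. -/
def removeNodes {P : Type*} (G : SimpleGraph P) (F : Finset P) : SimpleGraph P where
  Adj u v := G.Adj u v ∧ u ∉ F ∧ v ∉ F
  symm := ⟨fun _ _ h => ⟨h.1.symm, h.2.2, h.2.1⟩⟩
  loopless := ⟨fun u h => G.loopless.irrefl u h.1⟩

/-- The three implementations of `getDisjointPaths`. -/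
inductive PathSelection
  /-- all paths in the discovered graph -/
  | allPaths
  /-- for each choice of `f` nodes, `f + 1` disjoint paths that avoid them -/
  | removeFaults
  /-- `2f + 1` disjoint paths in the extended graph, when no two Byzantine nodes are neighbors -/
  | noByzantineNeighbors

/-- `S` is a possible value of `getDisjointPaths(T, u, v)` for the given implementation. -/
def PathSelection.Selects {P : Type*} [Fintype P] (T : P → P → Prop) (f : ℕ) (u v : P)
    (S : Finset (List P)) : PathSelection → Prop
  | .allPaths => ∀ l, l ∈ S ↔ IsPath (approvedGraph T) u v l
  | .removeFaults => ∃ sel : Finset P → Finset (List P),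
      (∀ F, F.card = f →
        (VertexDisjointPaths (removeNodes (approvedGraph T) F) u v (f + 1) (sel F) ∨
          (sel F = ∅ ∧
            ¬ ∃ D, VertexDisjointPaths (removeNodes (approvedGraph T) F) u v (f + 1) D))) ∧
      ∀ l, l ∈ S ↔ ∃ F, F.card = f ∧ l ∈ sel F
  | .noByzantineNeighbors => VertexDisjointPaths (extendedGraph T) u v (2 * f + 1) S

/-! ## The system -/

/-- The data of a system. The type `P` is the set of all node identifiers; the nodes that exist
are those in `correct ∪ byzantine`. -/
structure Network (P : Type*) where
  /-- the communication graph -/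
  graph : SimpleGraph P
  correct : Finset P
  byzantine : Finset P
  /-- the bound on the number of Byzantine nodes -/
  f : ℕ
  /-- the bound on the number of messages in transit over one link in one direction -/
  capacity : ℕ
  sender : P
  receiver : P
  /-- `topology i u v`: the directed edge `(u, v)` is in `ConfirmedTopology` of node `i` -/
  topology : P → P → P → Prop
  /-- `paths i d`: the value of `getDisjointPaths(ConfirmedTopology, i, d)` at node `i` -/
  paths : P → P → Finset (List P)

/-- A legal output of topology discovery: only existing nodes occur in it, and between
correct nodes it has exactly the edges of the communication graph. -/
def Network.LegalTopology {P : Type*} (net : Network P) (T : P → P → Prop) : Prop :=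
  (∀ u v, T u v →
    (u ∈ net.correct ∨ u ∈ net.byzantine) ∧ (v ∈ net.correct ∨ v ∈ net.byzantine)) ∧
  ∀ u ∈ net.correct, ∀ v ∈ net.correct, T u v ↔ net.graph.Adj u v

/-- The standing assumptions on the system. -/
structure Network.Admissible {P : Type*} [Fintype P] (net : Network P)
    (impl : PathSelection) : Prop where
  disjoint : Disjoint net.correct net.byzantine
  card_byzantine : net.byzantine.card ≤ net.f
  existing : ∀ u v, net.graph.Adj u v → u ∈ net.correct ∨ u ∈ net.byzantine
  sender_correct : net.sender ∈ net.correct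
  receiver_correct : net.receiver ∈ net.correct
  sender_ne_receiver : net.sender ≠ net.receiver
  connected : ∀ u ∈ net.correct, ∀ v ∈ net.correct, u ≠ v →
    ∃ S, VertexDisjointPaths net.graph u v (2 * net.f + 1) S
  legal_topology : ∀ i ∈ net.correct, net.LegalTopology (net.topology i)
  selects : ∀ i ∈ net.correct, ∀ d ∈ net.correct, i ≠ d →
    impl.Selects (net.topology i) net.f i d (net.paths i d)
  /-- Assumed only for the third implementation: no two Byzantine nodes are neighbors, and the
  discovered topology has the full neighborhood of every correct node. -/
  no_byzantine_neighbors : impl = .noByzantineNeighbors →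
    (∀ u ∈ net.byzantine, ∀ v ∈ net.byzantine, ¬ net.graph.Adj u v) ∧
    ∀ i ∈ net.correct, ∀ u ∈ net.correct, ∀ v, net.graph.Adj u v → net.topology i u v

/-! ## Messages, states and configurations -/

/-- The two types of transport layer messages. -/
inductive Kind
  | data
  | ack

/-- Transport layer messages. -/
structure Frame (P M : Type*) where
  source : P
  destination : P
  visited : List P
  intended : List P
  label : ZMod 3
  kind : Kind
  payload : M

structure SenderState (P M : Type*) where
  message : M
  label : ZMod 3
  approved : Bool
  /-- `Confirmations[receiver][Path]`, the most recent entry first -/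
  confirmations : List P → List (M × ZMod 3)

structure ReceiverState (P M : Type*) where
  currentLabel : ZMod 3
  /-- the payload and label that the acknowledgment loop currently sends; `none` means that the
  node is not in that loop -/
  acking : Option (M × ZMod 3)
  /-- `ReceivedMessages[sender][Path]`, the most recent entry first -/
  received : List P → List (M × ZMod 3)
  /-- everything that was delivered to the application layer, in this order -/
  output : List M

structure Config (P M : Type*) where
  /-- `channel i j`: the messages in transit from `i` to `j`, the oldest first -/
  channel : P → P → List (Frame P M)
  snd : SenderState P M
  rcv : ReceiverState P M

/-! ## The algorithm -/

open Classical in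
/-- The node that follows `i` on a path. -/
noncomputable def nextHop {P : Type*} (i : P) : List P → Option P
  | a :: b :: l => if a = i then some b else nextHop i (b :: l)
  | _ => none

open Classical in
/-- Node `i` sends `m` to the node `hop`; nothing is sent unless `hop` is a neighbor of `i`. -/
noncomputable def Network.transmit {P M : Type*} (net : Network P) (i : P) (hop : Option P)
    (m : Frame P M) (ch : P → P → List (Frame P M)) : P → P → List (Frame P M) :=
  fun u v => if u = i ∧ hop = some v ∧ net.graph.Adj u v then ch u v ++ [m] else ch u v

/-- `ByzantineFaultTolerantSend`, executed by node `i`. -/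
noncomputable def Network.faultTolerantSend {P M : Type*} (net : Network P) (i d : P)
    (label : ZMod 3) (kind : Kind) (payload : M) (ch : P → P → List (Frame P M)) :
    P → P → List (Frame P M) :=
  (net.paths i d).toList.foldl
    (fun ch l => net.transmit i (nextHop i l) ⟨i, d, [], l, label, kind, payload⟩ ch) ch

/-- The most recent `capacity * n + 1` entries of the queue all equal `x`. -/
def Network.FloodedPath {P X : Type*} [Fintype P] (net : Network P) (q : List X) (x : X) : Prop :=
  q.take (net.capacity * Fintype.card P + 1) =
    List.replicate (net.capacity * Fintype.card P + 1) x

/-- Among the visited paths in `S` (which start in `u` and do not list the destination `v`)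
there are `f + 1` vertex-disjoint simple paths from `u` to `v`. -/
def Network.NodeDisjointPaths {P : Type*} (net : Network P) (u v : P)
    (S : Set (List P)) : Prop :=
  ∃ D : Finset (List P), (∀ l ∈ D, ∃ Q ∈ S, l = Q ++ [v]) ∧
    VertexDisjointPaths (⊤ : SimpleGraph P) u v (net.f + 1) D

open Classical in
/-- Insert an entry at the head of the queue of a path. -/
noncomputable def enqueue {P X : Type*} (q : List P → List X) (Q : List P) (x : X) :
    List P → List X :=
  fun Q' => if Q' = Q then x :: q Q' else q Q'

open Classical in
/-- The receiver handles a data message of the sender. -/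
noncomputable def Network.onData {P M : Type*} [Fintype P] (net : Network P)
    (m : Frame P M) (st : ReceiverState P M) : ReceiverState P M :=
  let q := enqueue st.received m.visited (m.payload, m.label)
  if net.NodeDisjointPaths net.sender net.receiver
      {Q | net.FloodedPath (q Q) (m.payload, m.label)} then
    { currentLabel := m.label
      acking := some (m.payload, m.label)
      received := fun _ => []
      output := if st.currentLabel = m.label then st.output else st.output ++ [m.payload] }
  else { st with received := q }

open Classical in
/-- The sender handles an acknowledgment of the receiver. -/
noncomputable def Network.onAck {P M : Type*} [Fintype P] (net : Network P)
    (m : Frame P M) (st : SenderState P M) : SenderState P M :=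
  let q := if st.label = m.label then enqueue st.confirmations m.visited (m.payload, m.label)
    else st.confirmations
  { st with
    confirmations := q
    approved := if net.NodeDisjointPaths net.receiver net.sender
        {Q | net.FloodedPath (q Q) (m.payload, m.label)} then true else st.approved }

open Classical in
/-- Node `i` handles the message `m`, whose visited path already lists the last relay. -/
noncomputable def Network.handle {P M : Type*} [Fintype P] (net : Network P) (i : P)
    (m : Frame P M) (c : Config P M) : Config P M :=
  if m.destination ≠ i then
    { c with channel := net.transmit i (nextHop i m.intended) m c.channel }
  else match m.kind with
    | .data => if i = net.receiver ∧ m.source = net.sender then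
        { c with rcv := net.onData m c.rcv } else c
    | .ack => if i = net.sender ∧ m.source = net.receiver then
        { c with snd := net.onAck m c.snd } else c

open Classical in
/-- Node `i` receives the oldest message in the channel from `j`, if there is one. -/
noncomputable def Network.receiveStep {P M : Type*} [Fintype P] (net : Network P) (j i : P)
    (c : Config P M) : Config P M :=
  match c.channel j i with
  | [] => c
  | m :: rest => net.handle i { m with visited := m.visited ++ [j] }
      { c with channel := fun u v => if u = j ∧ v = i then rest else c.channel u v }

/-- The sender's state when it starts to send: it fetches the next message `x`, after clearing
its acknowledgment queues, if the current message is approved. -/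
def SenderState.prepare {P M : Type*} (x : M) (st : SenderState P M) : SenderState P M :=
  if st.approved then
    { message := x, label := st.label + 1, approved := false, confirmations := fun _ => [] }
  else st

open Classical in
/-- A timer step of node `i`: one iteration of its loop. If the sender fetches a message in this
step, then the upper layer supplies `x`. -/
noncomputable def Network.timerStep {P M : Type*} (net : Network P) (i : P) (x : M)
    (c : Config P M) : Config P M :=
  if i = net.sender then
    { c with
      snd := c.snd.prepare x
      channel := net.faultTolerantSend net.sender net.receiver (c.snd.prepare x).label .data
        (c.snd.prepare x).message c.channel }
  else if i = net.receiver then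
    match c.rcv.acking with
    | none => c
    | some (p, l) =>
      { c with channel := net.faultTolerantSend net.receiver net.sender l .ack p c.channel }
  else c

/-! ## Executions -/

inductive Action (P : Type*)
  | timer (i : P)
  | receive (j i : P)
  | byzantine (b : P)

/-- The atomic steps. A Byzantine node removes messages from the heads of its incoming channels
and sends arbitrary messages to its neighbors, as it likes. -/
inductive Network.Step {P M : Type*} [Fintype P] (net : Network P) :
    Config P M → Action P → Config P M → Prop
  | timer (c : Config P M) (i : P) (x : M) (hi : i ∈ net.correct) :
      Step net c (.timer i) (net.timerStep i x c)
  | receive (c : Config P M) (j i : P) (hi : i ∈ net.correct) (hadj : net.graph.Adj j i) :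
      Step net c (.receive j i) (net.receiveStep j i c)
  | byzantine (c : Config P M) (b : P) (ch : P → P → List (Frame P M))
      (hb : b ∈ net.byzantine)
      (hother : ∀ u v, u ≠ b → v ≠ b → ch u v = c.channel u v)
      (hout : ∀ v, v ≠ b → c.channel b v <+: ch b v)
      (hin : ∀ u, u ≠ b → ch u b <:+ c.channel u b) :
      Step net c (.byzantine b) { c with channel := ch }

/-- An execution from an arbitrary configuration; on every link between correct nodes
at most `capacity` messages are in transit. -/
structure Execution {P : Type*} [Fintype P] (net : Network P) (M : Type*) where
  config : ℕ → Config P M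
  action : ℕ → Action P
  step : ∀ t, net.Step (config t) (action t) (config (t + 1))
  bounded : ∀ t, ∀ i ∈ net.correct, ∀ j ∈ net.correct, net.graph.Adj i j →
    ((config t).channel i j).length ≤ net.capacity

section

variable {P M : Type*} [Fintype P] {net : Network P}

/-- Every correct node executes its loop, and receives from each neighbor, infinitely often. -/
def Execution.Fair (R : Execution net M) : Prop :=
  ∀ i ∈ net.correct, (∀ t, ∃ t' ≥ t, R.action t' = .timer i) ∧
    ∀ j, net.graph.Adj j i → ∀ t, ∃ t' ≥ t, R.action t' = .receive j i

/-- In the steps `a, …, b - 1` every correct node executes its loop, and receives from each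
neighbor, at least once. -/
def Execution.Covers (R : Execution net M) (a b : ℕ) : Prop :=
  ∀ i ∈ net.correct, (∃ t, a ≤ t ∧ t < b ∧ R.action t = .timer i) ∧
    ∀ j, net.graph.Adj j i → ∃ t, a ≤ t ∧ t < b ∧ R.action t = .receive j i

/-- The index of the configuration in which the first `k` asynchronous rounds end. -/
noncomputable def Execution.roundEnd (R : Execution net M) : ℕ → ℕ
  | 0 => 0
  | k + 1 => sInf {b | R.Covers (Execution.roundEnd R k) b}

/-- In step `t` the sender sends the message `m`. -/
def Execution.SendsAt (R : Execution net M) (t : ℕ) (m : M) : Prop :=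
  R.action t = .timer net.sender ∧ (R.config (t + 1)).snd.message = m

/-- In step `t` the sender fetches a message. -/
def Execution.FetchesAt (R : Execution net M) (t : ℕ) : Prop :=
  R.action t = .timer net.sender ∧ (R.config t).snd.approved = true

/-- In step `t` the receiver confirms `m`, that is, delivers it to the application layer. -/
def Execution.DeliversAt (R : Execution net M) (t : ℕ) (m : M) : Prop :=
  (R.config (t + 1)).rcv.output = (R.config t).rcv.output ++ [m]

open Classical in
/-- The number of fetches in the steps `0, …, t`. -/
noncomputable def Execution.fetchCount (R : Execution net M) (t : ℕ) : ℕ :=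
  ((Finset.range (t + 1)).filter fun t' => R.FetchesAt t').card

/-- The legal executions. A send step and a delivery step correspond when they concern the same
message and the sender fetches no other message between them. -/
structure Execution.Legal (R : Execution net M) : Prop where
  sent_delivered : ∀ t m, R.SendsAt t m →
    ∃ t', R.DeliversAt t' m ∧ R.fetchCount t' = R.fetchCount t
  delivered_sent : ∀ t' m, R.DeliversAt t' m →
    ∃ t < t', R.SendsAt t m ∧ R.fetchCount t = R.fetchCount t'
  delivered_once : ∀ t t' m m', R.DeliversAt t m → R.DeliversAt t' m' →
    R.fetchCount t = R.fetchCount t' → t = t'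

end

/-- Every fair execution that starts in `c` is legal. -/
def Network.Safe {P M : Type*} [Fintype P] (net : Network P) (c : Config P M) : Prop :=
  ∀ R : Execution net M, R.config 0 = c → R.Fair → R.Legal

end EndToEnd

namespace EndToEnd

open Classical

/-! ### Simple paths and families of vertex-disjoint paths. -/

section Paths

variable {P : Type*}

/-! Write C for `capacity * n`; the threshold for support is C + 1 equal entries on each of f + 1
vertex-disjoint paths. At least one of these paths has no Byzantine node. On such a path every node
has one successor, so at most C messages travel along it at any time. Hence C + 1 equal entries,
logged since the log was last empty, cannot all stem from messages that were in transit at that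
moment: the pair has been sent since then (`Execution.SupportsAt.exists_emitsAt`). The proof is an
accounting of messages in transit plus log entries (`Network.Step.potential_le`).

Safety. A fetch resets the approval and empties the log of acknowledgments, so between two
consecutive fetches the receiver sends an acknowledgment with the current label
(`Execution.exists_ack_of_fetches`). Three such intervals force acknowledgments with three
consecutive labels, so the acknowledged pair changes twice. The first change empties the receiver's
log; the pair of the second change has therefore been sent recently, within a window that contains
only three values of the fetch counter. As labels count fetches modulo 3, the label determines which
of them it was, and the receiver acknowledges the sender's current message at the fourth fetch
(`Execution.synced_of_fetches`). From then on `Synced 0` and `Synced 1` alternate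
(`Execution.Synced.phases`): a fetch leads from 0 to 1, a delivery leads from 1 to 0, and no other
delivery or fetch is possible. Legality follows.

Liveness. The path sets contain f + 1 disjoint paths of correct nodes
(`Network.Admissible.exists_correct_paths`). If one pair is sent persistently, C rounds flush all
other pairs from these paths, since channels are FIFO and bounded; after O(C) further rounds the
pair is supported (`Execution.Steady.exists_supportsAt`). Two applications to data and one to
acknowledgments yield a fetch within 19 C rounds, and four fetches take 76 C rounds.

Safety of a configuration concerns all executions that start in it, whereas `Synced` refers to the
past. Each such execution is therefore glued to the prefix of the given one (`Execution.splice`). -/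

theorem mem_of_path {G : SimpleGraph P} {u v : P} {l : List P} (h : IsPath G u v l) {x : P}
    (hx : x ∈ l) : x = u ∨ x = v ∨ x ∈ interior l := by
  obtain ⟨-, -, hu, hv⟩ := h
  cases l with
  | nil => simp at hx
  | cons a l =>
    simp only [List.head?_cons, Option.some.injEq] at hu
    subst hu
    rcases List.eq_nil_or_concat' l with rfl | ⟨l', b, rfl⟩
    · left; simpa using hx
    · have hb : b = v := by
        rw [← List.cons_append, List.getLast?_append] at hv
        simpa using hv
      subst hb
      simp only [interior, List.tail_cons, List.dropLast_concat]
      simp only [List.mem_cons, List.mem_append, List.not_mem_nil, or_false] at hx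
      tauto

theorem IsPath.exists_eq_cons_cons {G : SimpleGraph P} {u v : P} {l : List P}
    (h : IsPath G u v l) (huv : u ≠ v) : ∃ w l', l = u :: w :: l' := by
  obtain ⟨-, -, hu, hv⟩ := h
  match l with
  | [] => simp at hu
  | [a] => simp at hu hv; exact absurd (hu.symm.trans hv) huv
  | a :: b :: l => simp at hu; subst hu; exact ⟨b, l, rfl⟩

theorem IsPath.exists_eq_concat {G : SimpleGraph P} {u v : P} {l : List P}
    (h : IsPath G u v l) : ∃ Q, l = Q ++ [v] := by
  obtain ⟨-, -, -, hv⟩ := h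
  rcases List.eq_nil_or_concat' l with rfl | ⟨l', b, rfl⟩
  · simp at hv
  · rw [List.getLast?_append] at hv
    simp at hv
    exact ⟨l', by rw [hv]⟩

theorem IsPath.mono {G H : SimpleGraph P} {u v : P} {l : List P} (h : IsPath G u v l)
    (hGH : ∀ x ∈ l, ∀ y ∈ l, G.Adj x y → H.Adj x y) : IsPath H u v l :=
  ⟨h.1, h.2.1.imp_of_mem_imp (fun x y hx hy => hGH x hx y hy), h.2.2⟩

theorem exists_rel_of_isChain {R : P → P → Prop} {x : P} :
    ∀ {a b : P} {l : List P}, (a :: b :: l).IsChain R → x ∈ a :: b :: l → ∃ y, R x y ∨ R y x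
  | a, b, [], h, hx => by
    simp at h hx
    rcases hx with rfl | rfl
    · exact ⟨b, .inl h⟩
    · exact ⟨a, .inr h⟩
  | a, b, c :: l, h, hx => by
    rw [List.isChain_cons_cons] at h
    rcases List.mem_cons.1 hx with rfl | hx
    · exact ⟨b, .inl h.1⟩
    · exact exists_rel_of_isChain h.2 hx

theorem IsPath.exists_adj {G : SimpleGraph P} {u v : P} {l : List P} (h : IsPath G u v l)
    (huv : u ≠ v) {x : P} (hx : x ∈ l) : ∃ y, G.Adj x y := by
  obtain ⟨w, l', rfl⟩ := h.exists_eq_cons_cons huv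
  obtain ⟨y, hy | hy⟩ := exists_rel_of_isChain h.2.1 hx
  exacts [⟨y, hy⟩, ⟨y, hy.symm⟩]

/-- Removing `B` destroys at most `B.card` of a family of vertex-disjoint paths. -/
theorem VertexDisjointPaths.exists_avoiding {G : SimpleGraph P} {u v : P} {k m : ℕ}
    {S : Finset (List P)} (h : VertexDisjointPaths G u v k S) (B : Finset P)
    (hk : B.card + m ≤ k) :
    ∃ D ⊆ S, VertexDisjointPaths G u v m D ∧ ∀ l ∈ D, ∀ x ∈ interior l, x ∉ B := by
  obtain ⟨hc, hp, hd⟩ := h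
  set A := S.filter fun l => ∀ x ∈ interior l, x ∉ B with hA
  have hbad : (S.filter fun l => ¬ ∀ x ∈ interior l, x ∉ B).card ≤ B.card := by
    -- Each destroyed path is charged to one of its interior nodes in `B`; by disjointness no node
    -- is charged twice. For the other paths the value `u` is a dummy.
    have hex : ∀ l : List P, ∃ x, (¬ ∀ x ∈ interior l, x ∉ B) → x ∈ interior l ∧ x ∈ B := by
      intro l
      by_cases hl : ∀ x ∈ interior l, x ∉ B
      · exact ⟨u, fun h => absurd hl h⟩
      · have hl' := hl
        push Not at hl'
        obtain ⟨x, hx⟩ := hl'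
        exact ⟨x, fun _ => hx⟩
    choose φ hφ using hex
    refine Finset.card_le_card_of_injOn φ ?_ ?_
    · intro l hl
      exact (hφ l (Finset.mem_filter.1 hl).2).2
    · intro l hl l' hl' he
      have hl := Finset.mem_filter.1 hl
      have hl' := Finset.mem_filter.1 hl'
      by_contra hne
      have h1 := (hφ l hl.2).1
      have h2 := (hφ l' hl'.2).1
      exact hd l hl.1 l' hl'.1 hne h1 (he ▸ h2)
  have hsum : A.card + (S.filter fun l => ¬ ∀ x ∈ interior l, x ∉ B).card = S.card := by
    rw [hA]
    convert Finset.card_filter_add_card_filter_not (s := S) (fun l => ∀ x ∈ interior l, x ∉ B)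
  obtain ⟨D, hDA, hDc⟩ := Finset.exists_subset_card_eq (s := A) (n := m) (by omega)
  have hDS : D ⊆ S := hDA.trans (Finset.filter_subset _ _)
  exact ⟨D, hDS, ⟨hDc, fun l hl => hp l (hDS hl),
    fun l hl l' hl' => hd l (hDS hl) l' (hDS hl')⟩, fun l hl => (Finset.mem_filter.1 (hDA hl)).2⟩

theorem VertexDisjointPaths.mono {G H : SimpleGraph P} {u v : P} {k : ℕ}
    {S : Finset (List P)} (h : VertexDisjointPaths G u v k S)
    (hGH : ∀ l ∈ S, ∀ x ∈ l, ∀ y ∈ l, G.Adj x y → H.Adj x y) : VertexDisjointPaths H u v k S :=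
  ⟨h.1, fun l hl => (h.2.1 l hl).mono (hGH l hl), h.2.2⟩

theorem nextHop_eq_some {u v : P} :
    ∀ {A B : List P}, (A ++ u :: v :: B).Nodup → nextHop u (A ++ u :: v :: B) = some v
  | [], B, _ => by simp [nextHop]
  | [a], B, h => by
    have : a ≠ u := by rintro rfl; simp at h
    simp [nextHop, this]
  | a :: b :: A, B, h => by
    have hau : a ≠ u := by rintro rfl; simp at h
    have := nextHop_eq_some (A := b :: A) (B := B) (u := u) (v := v) (List.nodup_cons.1 h).2
    simp only [List.cons_append, nextHop, hau, if_false] at this ⊢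
    exact this

/-- The node `b` occurs only at the end of the path. This identifies the visited list of a message
that reaches the destination along a route. -/
theorem eq_of_prefix_concat {A Q : List P} {b : P} (h : (Q ++ [b]).Nodup)
    (hp : A ++ [b] <+: Q ++ [b]) : A = Q := by
  obtain ⟨s, hs⟩ := hp
  rcases List.eq_nil_or_concat' s with rfl | ⟨s', c, rfl⟩
  · simpa using hs
  · exfalso
    have h2 : (A ++ [b] ++ s') ++ [c] = Q ++ [b] := by simpa using hs
    obtain ⟨h3, h4⟩ := List.append_inj' h2 rfl
    rw [← h3] at h
    simp at h4
    subst h4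
    rw [List.nodup_append] at h
    exact h.2.2 c (by simp) c (by simp) rfl

/-- At most f of the 2f + 1 paths meet `B`. The graph `H` stands for the real or the reported
topology, and `B` may exceed the Byzantine set so that it can be padded to exactly f nodes. -/
theorem Network.exists_correct_paths_of_graph (net : Network P) {H : SimpleGraph P}
    {u v : P} (hu : u ∈ net.correct) (hv : v ∈ net.correct) (huv : u ≠ v)
    (hex : ∀ x y, H.Adj x y → x ∈ net.correct ∨ x ∈ net.byzantine) {B : Finset P}
    (hB : net.byzantine ⊆ B) (hBf : B.card ≤ net.f)
    {S : Finset (List P)} (hS : VertexDisjointPaths H u v (2 * net.f + 1) S) :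
    ∃ D ⊆ S, VertexDisjointPaths H u v (net.f + 1) D ∧ (∀ l ∈ D, ∀ x ∈ l, x ∈ net.correct) ∧
      ∀ l ∈ D, ∀ x ∈ l, x = u ∨ x = v ∨ x ∉ B := by
  obtain ⟨D, hDS, hD, hav⟩ := hS.exists_avoiding B (m := net.f + 1) (by omega)
  refine ⟨D, hDS, hD, fun l hl x hx => ?_, fun l hl x hx => ?_⟩
  · rcases mem_of_path (hD.2.1 l hl) hx with rfl | rfl | h
    · exact hu
    · exact hv
    · obtain ⟨y, hy⟩ := (hD.2.1 l hl).exists_adj huv hx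
      exact (hex x y hy).resolve_right fun hb => hav l hl x h (hB hb)
  · rcases mem_of_path (hD.2.1 l hl) hx with h | h | h
    · exact .inl h
    · exact .inr (.inl h)
    · exact .inr (.inr (hav l hl x h))

/-- A node has at most one successor on a simple route, so at most one of its outgoing channels
carries messages of that route. -/
theorem eq_of_prefix_of_nodup {W A B : List P} {u v w : P} (hW : W.Nodup)
    (hA : A ++ [u, v] <+: W) (hB : B ++ [u, w] <+: W) : v = w := by
  have hA1 : A ++ [u] <+: W := List.IsPrefix.trans ⟨[v], by simp⟩ hA
  have hB1 : B ++ [u] <+: W := List.IsPrefix.trans ⟨[w], by simp⟩ hB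
  have hlen : A.length = B.length := by
    have h1 := hA1.getElem (i := A.length) (by simp)
    have h2 := hB1.getElem (i := B.length) (by simp)
    simp only [List.getElem_concat_length] at h1 h2
    exact (hW.getElem_inj_iff).1 (h1.symm.trans h2)
  obtain ⟨s, hs⟩ := hA
  obtain ⟨s', hs'⟩ := hB
  have := hs.trans hs'.symm
  simp only [List.append_assoc] at this
  have := (List.append_inj this hlen).2
  simp only [List.cons_append, List.nil_append, List.cons.injEq, true_and] at this
  exact this.1

end Paths

/-! ### Enough correct paths in each of the three path selections. -/

section CorrectPaths

variable {P : Type*} [Fintype P] {net : Network P}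

/-- All paths but one need an interior node of their own, since `[u, v]` is the only path without
interior. With k = 2f + 1 this leaves room for a set of exactly f nodes other than `u` and `v`. -/
theorem VertexDisjointPaths.le_card {G : SimpleGraph P} {u v : P} {k : ℕ} {S : Finset (List P)}
    (h : VertexDisjointPaths G u v k S) (huv : u ≠ v) :
    k ≤ ((Finset.univ \ {u, v} : Finset P)).card + 1 := by
  by_contra hlt
  push Not at hlt
  obtain ⟨D, hDS, hD, hav⟩ := h.exists_avoiding (Finset.univ \ {u, v}) (m := 2) (by omega)
  obtain ⟨l, l', hne, hDe⟩ := Finset.card_eq_two.1 hD.1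
  have key : ∀ l ∈ D, l = [u, v] := by
    intro l hl
    have hp := hD.2.1 l hl
    obtain ⟨w, l', rfl⟩ := hp.exists_eq_cons_cons huv
    obtain ⟨Q, hQ⟩ := hp.exists_eq_concat
    have hint : interior (u :: w :: l') = [] := by
      by_contra hn
      obtain ⟨x, hx⟩ := List.exists_mem_of_ne_nil _ hn
      have hx2 := hav _ hl x hx
      have hn := hp.1
      have hQ1 : w :: l' = (w :: l').dropLast ++ [v] := by
        rcases Q with _ | ⟨q, Q⟩
        · simp at hQ
        · simp only [List.cons_append, List.cons.injEq] at hQ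
          rw [hQ.2, List.dropLast_concat]
      simp only [interior, List.tail_cons] at hx
      rw [hQ1, List.nodup_cons, List.nodup_append] at hn
      simp only [Finset.mem_sdiff, Finset.mem_univ, true_and, not_not, Finset.mem_insert,
        Finset.mem_singleton] at hx2
      rcases hx2 with rfl | rfl
      · exact hn.1 (List.mem_append_left _ hx)
      · exact hn.2.2.2 _ hx _ (by simp) rfl
    simp only [interior, List.tail_cons] at hint
    rcases l' with _ | ⟨b, l'⟩
    · have := hp.2.2.2
      simp at this
      rw [this]
    · simp at hint
  exact hne ((key l (by simp [hDe])).trans (key l' (by simp [hDe])).symm)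

/-- Among the paths that a correct node uses towards another one there are `f + 1`
vertex-disjoint ones without Byzantine nodes. -/
theorem Network.Admissible.exists_correct_paths {impl : PathSelection}
    (hnet : net.Admissible impl) {u v : P} (hu : u ∈ net.correct) (hv : v ∈ net.correct)
    (huv : u ≠ v) :
    ∃ D ⊆ net.paths u v, VertexDisjointPaths net.graph u v (net.f + 1) D ∧
      ∀ l ∈ D, ∀ x ∈ l, x ∈ net.correct := by
  have hT := hnet.legal_topology u hu
  have hsel := hnet.selects u hu v hv huv
  obtain ⟨S, hS⟩ := hnet.connected u hu v hv huv
  have happ : ∀ x ∈ net.correct, ∀ y ∈ net.correct,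
      ((approvedGraph (net.topology u)).Adj x y ↔ net.graph.Adj x y) := fun x hx y hy =>
    ⟨fun h => (hT.2 x hx y hy).1 h.2.1,
      fun h => ⟨h.ne, (hT.2 x hx y hy).2 h, (hT.2 y hy x hx).2 h.symm⟩⟩
  cases impl with
  | allPaths =>
    -- Correct paths of the real graph consist of approved edges, so a selection of all approved
    -- paths contains them.
    obtain ⟨D, -, hD, hDc, -⟩ := net.exists_correct_paths_of_graph hu hv huv hnet.existing
      subset_rfl hnet.card_byzantine hS
    refine ⟨D, fun l hl => (hsel l).2 ?_, hD, hDc⟩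
    exact (hD.2.1 l hl).mono fun x hx y hy h => (happ x (hDc l hl x hx) y (hDc l hl y hy)).2 h
  | removeFaults =>
    obtain ⟨sel, hsel, hmem⟩ := hsel
    have hcard := hS.le_card huv
    have hsub : net.byzantine ⊆ Finset.univ \ {u, v} := by
      intro x hx
      simp only [Finset.mem_sdiff, Finset.mem_univ, true_and, Finset.mem_insert,
        Finset.mem_singleton]
      rintro (rfl | rfl)
      · exact Finset.disjoint_left.1 hnet.disjoint hu hx
      · exact Finset.disjoint_left.1 hnet.disjoint hv hx
    -- The selection is indexed by sets of exactly f nodes, so the Byzantine set is enlarged to such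
    -- a set while the two end nodes are spared.
    obtain ⟨F, hBF, hF, hFc⟩ := Finset.exists_subsuperset_card_eq hsub hnet.card_byzantine
      (by omega)
    have huF : u ∉ F := fun h => by simpa using hF h
    have hvF : v ∉ F := fun h => by simpa using hF h
    obtain ⟨D, -, hD, hDc, hDF⟩ := net.exists_correct_paths_of_graph hu hv huv hnet.existing
      hBF hFc.le hS
    have hDF' : ∀ l ∈ D, ∀ x ∈ l, x ∉ F := by
      intro l hl x hx
      rcases hDF l hl x hx with rfl | rfl | h
      exacts [huF, hvF, h]
    have hD' : VertexDisjointPaths (removeNodes (approvedGraph (net.topology u)) F) u v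
        (net.f + 1) D := hD.mono fun l hl x hx y hy h =>
      ⟨(happ x (hDc l hl x hx) y (hDc l hl y hy)).2 h, hDF' l hl x hx, hDF' l hl y hy⟩
    -- The paths chosen for `F` need not be those in `D`; the family `D` only shows that the choice
    -- is not empty. The chosen paths avoid `F`, hence all Byzantine nodes.
    have hselF := (hsel F hFc).resolve_right fun h => h.2 ⟨D, hD'⟩
    have hc : ∀ l ∈ sel F, ∀ x ∈ l, x ∈ net.correct := by
      intro l hl x hx
      obtain ⟨y, hy⟩ := (hselF.2.1 l hl).exists_adj huv hx
      exact (hT.1 x y hy.1.2.1).1.resolve_right fun hb => hy.2.1 (hBF hb)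
    exact ⟨sel F, fun l hl => (hmem l).2 ⟨F, hFc, hl⟩, hselF.mono fun l hl x hx y hy h =>
      (happ x (hc l hl x hx) y (hc l hl y hy)).1 h.1, hc⟩
  | noByzantineNeighbors =>
    obtain ⟨D, hDS, hD, hDc, -⟩ := net.exists_correct_paths_of_graph
      (H := extendedGraph (net.topology u)) hu hv huv
      (fun x y h => h.2.elim (fun h => (hT.1 x y h).1) fun h => (hT.1 y x h).2)
      subset_rfl hnet.card_byzantine hsel
    refine ⟨D, hDS, hD.mono fun l hl x hx y hy h => ?_, hDc⟩
    have hx := hDc l hl x hx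
    have hy := hDc l hl y hy
    exact h.2.elim (hT.2 x hx y hy).1 fun h => ((hT.2 y hy x hx).1 h).symm

end CorrectPaths

/-! ### Data and acknowledgments in a uniform notation, and the effect of single steps. -/

section Routing

variable {P M : Type*}

/-- The node from which transport layer messages of type `k` originate. -/
def Network.src (net : Network P) : Kind → P
  | .data => net.sender
  | .ack => net.receiver

/-- The node to which transport layer messages of type `k` are addressed. -/
def Network.dst (net : Network P) : Kind → P
  | .data => net.receiver
  | .ack => net.sender

/-- The log that is filled by messages of type `k`. -/
def Config.log (c : Config P M) : Kind → List P → List (M × ZMod 3)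
  | .data => c.rcv.received
  | .ack => c.snd.confirmations

/-- The payload and label that the origin of messages of type `k` is sending. -/
def Config.outgoing (c : Config P M) : Kind → Option (M × ZMod 3)
  | .data => some (c.snd.message, c.snd.label)
  | .ack => c.rcv.acking

/-- Messages of type `k` with label `l` are logged in `c`. -/
def Config.Accepts (c : Config P M) : Kind → ZMod 3 → Prop
  | .data, _ => True
  | .ack, l => c.snd.label = l

def Frame.pair (m : Frame P M) : M × ZMod 3 := (m.payload, m.label)

/-- The message after it has been received from `j`. -/
def Frame.hop (m : Frame P M) (j : P) : Frame P M := { m with visited := m.visited ++ [j] }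

/-- `m` is a message of type `k` between sender and receiver. -/
def Network.Carries (net : Network P) (k : Kind) (m : Frame P M) : Prop :=
  m.source = net.src k ∧ m.destination = net.dst k ∧ m.kind = k

/-- The log of type `k` after `m` is recorded and before it is possibly cleared. -/
noncomputable def Config.logWith (c : Config P M) (k : Kind) (m : Frame P M) :
    List P → List (M × ZMod 3) :=
  if c.Accepts k m.label then enqueue (c.log k) m.visited m.pair else c.log k

/-- `x` is recorded often enough, on sufficiently many disjoint paths. -/
def Network.Supported [Fintype P] (net : Network P) (k : Kind) (q : List P → List (M × ZMod 3))
    (x : M × ZMod 3) : Prop :=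
  net.NodeDisjointPaths (net.src k) (net.dst k) {Q | net.FloodedPath (q Q) x}

/-- The channels after the oldest message from `j` to `i` is removed, where `rest` remains. -/
noncomputable def pop (j i : P) (rest : List (Frame P M)) (ch : P → P → List (Frame P M)) :
    P → P → List (Frame P M) :=
  fun u v => if u = j ∧ v = i then rest else ch u v

theorem transmit_none (net : Network P) (i : P) (m : Frame P M)
    (ch : P → P → List (Frame P M)) : net.transmit i none m ch = ch := by
  funext u v
  simp [Network.transmit]

theorem transmit_of_not_adj {net : Network P} {ch : P → P → List (Frame P M)}
    {i v : P} (hv : ¬ net.graph.Adj i v) (m : Frame P M) :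
    net.transmit i (some v) m ch = ch := by
  funext a b
  simp only [Network.transmit, Option.some.injEq, ite_eq_right_iff]
  rintro ⟨rfl, rfl, h⟩
  exact absurd h hv

theorem src_ne_dst {net : Network P} (hne : net.sender ≠ net.receiver) (k : Kind) :
    net.src k ≠ net.dst k := by
  cases k
  exacts [hne, hne.symm]

/-- The effect of a timer step on the channels. -/
theorem timerStep_channel {net : Network P} (hne : net.sender ≠ net.receiver) (k : Kind) (x : M)
    (c : Config P M) :
    (net.timerStep (net.src k) x c).channel =
      match (net.timerStep (net.src k) x c).outgoing k with
      | none => c.channel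
      | some y => net.faultTolerantSend (net.src k) (net.dst k) y.2 k y.1 c.channel := by
  cases k with
  | data => simp [Network.timerStep, Network.src, Network.dst, Config.outgoing]
  | ack =>
    simp only [Network.timerStep, Network.src, Network.dst, Config.outgoing, hne.symm, if_false,
      if_true]
    rcases h : c.rcv.acking with _ | ⟨p, l⟩ <;> simp [h]

theorem timerStep_rcv (net : Network P) (i : P) (x : M) (c : Config P M) :
    (net.timerStep i x c).rcv = c.rcv := by
  unfold Network.timerStep
  split_ifs <;> try rfl
  split <;> rfl

theorem timerStep_snd_of_ne {net : Network P} {i : P} (hi : i ≠ net.sender) (x : M)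
    (c : Config P M) : (net.timerStep i x c).snd = c.snd := by
  unfold Network.timerStep
  rw [if_neg hi]
  split_ifs <;> try rfl
  split <;> rfl

theorem timerStep_snd (net : Network P) (x : M) (c : Config P M) :
    (net.timerStep net.sender x c).snd = c.snd.prepare x := by
  simp [Network.timerStep]

theorem timerStep_of_ne {net : Network P} {i : P} (hi : ∀ k, i ≠ net.src k) (x : M)
    (c : Config P M) : net.timerStep i x c = c := by
  have h1 : i ≠ net.sender := hi .data
  have h2 : i ≠ net.receiver := hi .ack
  simp [Network.timerStep, h1, h2]

theorem logWith_data (m : Frame P M) (c : Config P M) :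
    c.logWith .data m = enqueue c.rcv.received m.visited (m.payload, m.label) :=
  if_pos trivial

theorem logWith_ack (m : Frame P M) (c : Config P M) :
    c.logWith .ack m = if c.snd.label = m.label then
      enqueue c.snd.confirmations m.visited (m.payload, m.label) else c.snd.confirmations := by
  by_cases h : c.snd.label = m.label
  · rw [if_pos h]; exact if_pos h
  · rw [if_neg h]; exact if_neg h

theorem mem_logWith_ack {c : Config P M} {m : Frame P M} {Q : List P} {e : M × ZMod 3}
    (h : e ∈ c.logWith .ack m Q) : e ∈ c.snd.confirmations Q ∨ e.2 = c.snd.label := by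
  rw [logWith_ack] at h
  split_ifs at h with hl
  · unfold enqueue at h
    split_ifs at h
    · rcases List.mem_cons.1 h with rfl | h
      · exact .inr hl.symm
      · exact .inl h
    · exact .inl h
  · exact .inl h

variable [Fintype P]

/-- The possible effects of the receipt of a message. -/
inductive Network.Receipt (net : Network P) (j i : P) (c : Config P M) : Config P M → Prop
  | empty (h : c.channel j i = []) : Receipt net j i c c
  | forward (m : Frame P M) (rest : List (Frame P M)) (h : c.channel j i = m :: rest)
      (hi : m.destination ≠ i) : Receipt net j i c
        { c with channel := net.transmit i (nextHop i m.intended) (m.hop j)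
                    (pop j i rest c.channel) }
  | discard (m : Frame P M) (rest : List (Frame P M)) (h : c.channel j i = m :: rest)
      (hi : m.destination = i) (hm : ∀ k, i = net.dst k → ¬ net.Carries k m) :
      Receipt net j i c { c with channel := pop j i rest c.channel }
  | data (m : Frame P M) (rest : List (Frame P M)) (h : c.channel j i = m :: rest)
      (hi : i = net.dst .data) (hm : net.Carries .data m) :
      Receipt net j i c
        { c with channel := pop j i rest c.channel, rcv := net.onData (m.hop j) c.rcv }
  | ack (m : Frame P M) (rest : List (Frame P M)) (h : c.channel j i = m :: rest)
      (hi : i = net.dst .ack) (hm : net.Carries .ack m) :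
      Receipt net j i c
        { c with channel := pop j i rest c.channel, snd := net.onAck (m.hop j) c.snd }

theorem receipt_receiveStep (net : Network P) (j i : P) (c : Config P M) :
    net.Receipt j i c (net.receiveStep j i c) := by
  unfold Network.receiveStep
  rcases h : c.channel j i with _ | ⟨m, rest⟩
  · exact .empty h
  · simp only [Network.handle]
    by_cases hd : m.destination = i
    · rw [if_neg (not_not.2 hd)]
      rcases hk : m.kind with _ | _
      · by_cases hs : i = net.receiver ∧ m.source = net.sender
        · rw [if_pos hs]
          have h1 := Network.Receipt.data (c := c) m rest h hs.1 ⟨hs.2, hd.trans hs.1, hk⟩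
          simp only [Frame.hop, hk] at h1
          exact h1
        · rw [if_neg hs]
          refine .discard m rest h hd fun k hki hc => ?_
          obtain rfl : k = .data := hc.2.2.symm.trans hk
          exact hs ⟨hki, hc.1⟩
      · by_cases hs : i = net.sender ∧ m.source = net.receiver
        · rw [if_pos hs]
          have h1 := Network.Receipt.ack (c := c) m rest h hs.1 ⟨hs.2, hd.trans hs.1, hk⟩
          simp only [Frame.hop, hk] at h1
          exact h1
        · rw [if_neg hs]
          refine .discard m rest h hd fun k hki hc => ?_
          obtain rfl : k = .ack := hc.2.2.symm.trans hk
          exact hs ⟨hki, hc.1⟩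
    · rw [if_pos hd]
      exact .forward m rest h hd

theorem onData_eq (net : Network P) (m : Frame P M) (c : Config P M) :
    net.onData m c.rcv = if net.Supported .data (c.logWith .data m) m.pair then
        { currentLabel := m.label
          acking := some m.pair
          received := fun _ => []
          output := if c.rcv.currentLabel = m.label then c.rcv.output
            else c.rcv.output ++ [m.payload] }
      else { c.rcv with received := c.logWith .data m } := by
  rw [logWith_data]
  rfl

theorem onAck_eq (net : Network P) (m : Frame P M) (c : Config P M) :
    net.onAck m c.snd = { c.snd with
      confirmations := c.logWith .ack m
      approved := if net.Supported .ack (c.logWith .ack m) m.pair then true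
        else c.snd.approved } := by
  rw [logWith_ack]
  rfl

end Routing

/-! ### Messages in transit along a fixed route. -/

section Load

variable {P M : Type*} {net : Network P}

/-- A message with property `g` that is in transit from `u` to `v` and that has followed the
route `W` so far. -/
def OnRoute (W : List P) (g : Frame P M → Prop) (u v : P) (m : Frame P M) : Prop :=
  g m ∧ m.visited ++ [u, v] <+: W

/-- A property of messages that does not depend on the list of visited nodes. -/
def VisitedFree (g : Frame P M → Prop) : Prop :=
  ∀ (m : Frame P M) (L : List P), g { m with visited := L } ↔ g m

theorem OnRoute.of_hop {W : List P} {g : Frame P M → Prop} (hg : VisitedFree g) {j i v : P}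
    {m : Frame P M} (h : OnRoute W g i v (m.hop j)) : OnRoute W g j i m := by
  refine ⟨(hg m _).1 h.1, List.IsPrefix.trans ⟨[v], ?_⟩ h.2⟩
  simp [Frame.hop]

variable [Fintype P]

/-- The number of messages with property `g` in transit along the route `W`. -/
noncomputable def load (net : Network P) (W : List P) (g : Frame P M → Prop)
    (ch : P → P → List (Frame P M)) : ℕ :=
  ∑ e : P × P, if net.graph.Adj e.1 e.2 then
    (ch e.1 e.2).countP fun m => decide (OnRoute W g e.1 e.2 m) else 0

variable {W : List P} {g : Frame P M → Prop} {ch : P → P → List (Frame P M)}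

theorem load_transmit {i v : P} (hv : net.graph.Adj i v) (m : Frame P M) :
    load net W g (net.transmit i (some v) m ch) =
      load net W g ch + if OnRoute W g i v m then 1 else 0 := by
  have h1 : (if OnRoute W g i v m then 1 else 0) =
      ∑ e : P × P, if e = (i, v) then (if OnRoute W g i v m then 1 else 0) else 0 := by
    simp
  rw [h1, load, load, ← Finset.sum_add_distrib]
  refine Finset.sum_congr rfl fun ⟨a, b⟩ _ => ?_
  by_cases hab : a = i ∧ b = v
  · obtain ⟨rfl, rfl⟩ := hab
    simp [Network.transmit, hv, List.countP_append, List.countP_singleton]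
  · have h2 : ¬ (a = i ∧ v = b ∧ net.graph.Adj a b) := fun h => hab ⟨h.1, h.2.1.symm⟩
    simp only [Network.transmit, Prod.mk.injEq, hab, if_false, add_zero, Option.some.injEq, h2]

theorem load_le_load_transmit (i : P) (hop : Option P) (m : Frame P M) :
    load net W g ch ≤ load net W g (net.transmit i hop m ch) := by
  rcases hop with _ | v
  · rw [transmit_none]
  · by_cases hv : net.graph.Adj i v
    · rw [load_transmit hv]; exact Nat.le_add_right _ _
    · rw [transmit_of_not_adj hv]

theorem load_transmit_of_not (i : P) (hop : Option P) {m : Frame P M}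
    (hm : ∀ v, ¬ OnRoute W g i v m) :
    load net W g (net.transmit i hop m ch) = load net W g ch := by
  rcases hop with _ | v
  · rw [transmit_none]
  · by_cases hv : net.graph.Adj i v
    · rw [load_transmit hv, if_neg (hm v), add_zero]
    · rw [transmit_of_not_adj hv]

theorem load_pop {j i : P} {m : Frame P M} {rest : List (Frame P M)} (hv : net.graph.Adj j i)
    (h : ch j i = m :: rest) :
    load net W g (pop j i rest ch) + (if OnRoute W g j i m then 1 else 0) = load net W g ch := by
  have h1 : (if OnRoute W g j i m then 1 else 0) =
      ∑ e : P × P, if e = (j, i) then (if OnRoute W g j i m then 1 else 0) else 0 := by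
    simp
  rw [h1, load, load, ← Finset.sum_add_distrib]
  refine Finset.sum_congr rfl fun ⟨a, b⟩ _ => ?_
  by_cases hab : a = j ∧ b = i
  · obtain ⟨rfl, rfl⟩ := hab
    simp [pop, hv, h, List.countP_cons]
  · simp only [pop, Prod.mk.injEq, hab, if_false, add_zero]

theorem load_faultTolerantSend_of_not {i d : P} {l : ZMod 3} {k : Kind} {x : M}
    (hg : ∀ L, ¬ g ⟨i, d, [], L, l, k, x⟩) :
    load net W g (net.faultTolerantSend i d l k x ch) = load net W g ch := by
  unfold Network.faultTolerantSend
  induction (net.paths i d).toList generalizing ch with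
  | nil => rfl
  | cons L Ls ih =>
    rw [List.foldl_cons, ih, load_transmit_of_not _ _ fun v h => hg L h.1]

theorem load_le_load_foldl {i d : P} {l : ZMod 3} {k : Kind} {x : M} (Ls : List (List P)) :
    load net W g ch ≤ load net W g (Ls.foldl
      (fun ch L => net.transmit i (nextHop i L) ⟨i, d, [], L, l, k, x⟩ ch) ch) := by
  induction Ls generalizing ch with
  | nil => exact le_rfl
  | cons L Ls ih => exact (load_le_load_transmit _ _ _).trans ih

theorem load_lt_load_faultTolerantSend {i d v : P} {l : ZMod 3} {k : Kind} {x : M} {L : List P}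
    (hL : L ∈ net.paths i d) (hnext : nextHop i L = some v) (hv : net.graph.Adj i v)
    (hr : OnRoute W g i v ⟨i, d, [], L, l, k, x⟩) :
    load net W g ch + 1 ≤ load net W g (net.faultTolerantSend i d l k x ch) := by
  unfold Network.faultTolerantSend
  obtain ⟨A, B, hAB⟩ := List.append_of_mem (Finset.mem_toList.2 hL)
  rw [hAB, List.foldl_append, List.foldl_cons]
  refine le_trans ?_ (load_le_load_foldl B)
  rw [hnext, load_transmit hv, if_pos hr]
  exact Nat.add_le_add_right (load_le_load_foldl A) 1

/-- Both ends of a channel that carries messages of the route lie on the route, and a Byzantine node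
outside it only touches channels that end or start in itself. Forged visited lists do not help,
since the last hop is recorded by its receiver. -/
theorem load_byzantine {b : P} (hb : b ∉ W) {ch' : P → P → List (Frame P M)}
    (h : ∀ u v, u ≠ b → v ≠ b → ch' u v = ch u v) : load net W g ch' = load net W g ch := by
  refine Finset.sum_congr rfl fun ⟨u, v⟩ _ => ?_
  by_cases huv : u ≠ b ∧ v ≠ b
  · simp only [h u v huv.1 huv.2]
  · have : ∀ m : Frame P M, ¬ OnRoute W g u v m := by
      rintro m ⟨-, hp⟩
      have hu : u ∈ W := hp.subset (by simp)
      have hv : v ∈ W := hp.subset (by simp)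
      refine huv ⟨?_, ?_⟩
      · rintro rfl; exact hb hu
      · rintro rfl; exact hb hv
    simp [this]

theorem load_le {impl : PathSelection} (hnet : net.Admissible impl) (hW : W.Nodup)
    (hWb : ∀ x ∈ W, x ∉ net.byzantine)
    (hch : ∀ i ∈ net.correct, ∀ j ∈ net.correct, net.graph.Adj i j →
      (ch i j).length ≤ net.capacity) :
    load net W g ch ≤ net.capacity * Fintype.card P := by
  rw [load, Fintype.sum_prod_type]
  -- Only the channel from `u` to its successor on `W` contributes. Both of its ends are correct, so
  -- the capacity bound applies.
  have key : ∀ u : P, (∑ v, if net.graph.Adj u v then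
      (ch u v).countP fun m => decide (OnRoute W g u v m) else 0) ≤ net.capacity := by
    intro u
    by_cases hex : ∃ v A, A ++ [u, v] <+: W
    · obtain ⟨v, A, hA⟩ := hex
      rw [Finset.sum_eq_single v]
      · split_ifs with hadj
        · refine List.countP_le_length.trans (hch u ?_ v ?_ hadj)
          · exact (hnet.existing u v hadj).resolve_right (hWb u (hA.subset (by simp)))
          · exact (hnet.existing v u hadj.symm).resolve_right (hWb v (hA.subset (by simp)))
        · exact Nat.zero_le _
      · intro w _ hw
        split_ifs
        · rw [List.countP_eq_zero]
          intro m _ hm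
          exact hw (eq_of_prefix_of_nodup hW (of_decide_eq_true hm).2 hA)
        · rfl
      · simp
    · rw [Finset.sum_eq_zero]
      · exact Nat.zero_le _
      · intro v _
        split_ifs
        · rw [List.countP_eq_zero]
          intro m _ hm
          exact hex ⟨v, _, (of_decide_eq_true hm).2⟩
        · rfl
  calc _ ≤ ∑ _u : P, net.capacity := Finset.sum_le_sum fun u _ => key u
    _ = _ := by simp [mul_comm]

end Load

/-! ### The potential: messages in transit plus entries in the log. -/

section Potential

variable {P M : Type*} {net : Network P}

/-- A step with action `a` that leads to `c'` sends the pair `x` in messages of type `k`. -/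
def Network.Emits (net : Network P) (k : Kind) (x : M × ZMod 3) (a : Action P)
    (c' : Config P M) : Prop :=
  a = .timer (net.src k) ∧ c'.outgoing k = some x

theorem log_timerStep (net : Network P) (i : P) (y : M) (c : Config P M) (k : Kind) :
    (net.timerStep i y c).log k = c.log k ∨
      ((net.timerStep i y c).log k = fun _ => []) ∧ k = .ack ∧ i = net.sender ∧
        c.snd.approved = true := by
  cases k with
  | data => left; simp only [Config.log, timerStep_rcv]
  | ack =>
    by_cases hi : i = net.sender
    · subst hi
      simp only [Config.log, timerStep_snd, SenderState.prepare]
      split_ifs with h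
      · exact .inr ⟨rfl, trivial, trivial, h⟩
      · exact .inl rfl
    · left; simp only [Config.log, timerStep_snd_of_ne hi]

/-- A new entry `x` for `Q` is paid for by a message that was on the last edge of the route `Q ++
[net.dst k]` and now leaves the load. -/
theorem countP_logWith_le {k : Kind} {x : M × ZMod 3} {Q : List P} {c : Config P M} {j : P}
    {m : Frame P M} (hm : net.Carries k m) :
    ((c.logWith k (m.hop j) Q).countP fun y => decide (y = x)) ≤
      ((c.log k Q).countP fun y => decide (y = x)) +
      if OnRoute (Q ++ [net.dst k]) (fun m => net.Carries k m ∧ m.pair = x) j (net.dst k) m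
        then 1 else 0 := by
  unfold Config.logWith
  split_ifs with h1 h2 h2
  · unfold enqueue
    split_ifs with h3
    · rw [List.countP_cons]; split_ifs <;> omega
    · omega
  · unfold enqueue
    split_ifs with h3
    · rw [List.countP_cons_of_neg]
      · omega
      · intro hx
        refine h2 ⟨⟨hm, of_decide_eq_true hx⟩, ?_⟩
        rw [h3]
        simp [Frame.hop]
    · omega
  · omega
  · omega

variable [Fintype P]

/-- A step with action `a` from `c` is the receipt of a message of type `k` whose pair `x` is
then supported. -/
def Network.Supports (net : Network P) (k : Kind) (x : M × ZMod 3) (c : Config P M)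
    (a : Action P) : Prop :=
  ∃ j m rest, a = .receive j (net.dst k) ∧ net.graph.Adj j (net.dst k) ∧
    c.channel j (net.dst k) = m :: rest ∧ net.Carries k m ∧ m.pair = x ∧
    net.Supported k (c.logWith k (m.hop j)) x

theorem Network.Step.receipt {c c' : Config P M} {j i : P}
    (h : net.Step c (.receive j i) c') : net.Receipt j i c c' ∧ net.graph.Adj j i := by
  cases h with
  | receive _ _ hi hadj => exact ⟨receipt_receiveStep net j i c, hadj⟩

theorem Network.Step.timer_eq {c c' : Config P M} {i : P} (h : net.Step c (.timer i) c') :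
    ∃ y, c' = net.timerStep i y c := by
  cases h with
  | timer _ y => exact ⟨y, rfl⟩

theorem Network.Step.byzantine_eq {c c' : Config P M} {b : P}
    (h : net.Step c (.byzantine b) c') : b ∈ net.byzantine ∧ c'.snd = c.snd ∧ c'.rcv = c.rcv ∧
      ∀ u v, u ≠ b → v ≠ b → c'.channel u v = c.channel u v := by
  cases h with
  | byzantine _ ch hb hother => exact ⟨hb, rfl, rfl, hother⟩

/-- What is on the route after a hop was on it before. Forwarding thus gives back at most the unit
that the removal from the incoming channel took away. -/
theorem load_transmit_hop_le {W : List P} {g : Frame P M → Prop} (hg : VisitedFree g) (j i : P)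
    (hop : Option P) (m : Frame P M) (ch : P → P → List (Frame P M)) :
    load net W g (net.transmit i hop (m.hop j) ch) ≤
      load net W g ch + if OnRoute W g j i m then 1 else 0 := by
  split_ifs with h
  · rcases hop with _ | v
    · rw [transmit_none]; exact Nat.le_succ _
    · by_cases hv : net.graph.Adj i v
      · rw [load_transmit hv]; split_ifs <;> omega
      · rw [transmit_of_not_adj hv]; exact Nat.le_succ _
  · rw [load_transmit_of_not _ _ fun v hv => h (hv.of_hop hg), add_zero]

/-- The load of a route does not increase unless the message is new. -/
theorem load_timerStep_of_not {W : List P} {g : Frame P M → Prop}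
    (hne : net.sender ≠ net.receiver) {i : P} {y : M} {c : Config P M}
    (hg : ∀ k x L, net.Emits k x (.timer i) (net.timerStep i y c) →
      ¬ g ⟨net.src k, net.dst k, [], L, x.2, k, x.1⟩) :
    load net W g (net.timerStep i y c).channel = load net W g c.channel := by
  by_cases hi : ∃ k, i = net.src k
  · obtain ⟨k, rfl⟩ := hi
    rw [timerStep_channel hne]
    rcases h : (net.timerStep (net.src k) y c).outgoing k with _ | x
    · rfl
    · exact load_faultTolerantSend_of_not fun L => hg k x L ⟨rfl, h⟩
  · push Not at hi
    rw [timerStep_of_ne hi]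

/-- The messages with pair `x` that can be logged for the visited path `Q`, and the entries
`x` of its log. -/
noncomputable def potential (net : Network P) (k : Kind) (x : M × ZMod 3) (Q : List P)
    (c : Config P M) : ℕ :=
  load net (Q ++ [net.dst k]) (fun m => net.Carries k m ∧ m.pair = x) c.channel +
    (c.log k Q).countP fun y => decide (y = x)

/-- Relays move messages along the route, receipt turns a message into at most one entry, and
clearing a log only loses entries. Byzantine nodes are off the route, so only the origin can create
new units. -/
theorem Network.Step.potential_le (hne : net.sender ≠ net.receiver) {c c' : Config P M}
    {a : Action P} (h : net.Step c a c') {k : Kind} {x : M × ZMod 3} {Q : List P}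
    (hQ : ∀ y ∈ Q ++ [net.dst k], y ∉ net.byzantine) (hno : ¬ net.Emits k x a c') :
    potential net k x Q c' ≤ potential net k x Q c := by
  have hfree : VisitedFree fun m : Frame P M => net.Carries k m ∧ m.pair = x :=
    fun _ _ => Iff.rfl
  unfold potential
  cases a with
  | timer i =>
    obtain ⟨y, rfl⟩ := h.timer_eq
    rw [load_timerStep_of_not hne]
    · rcases log_timerStep net i y c k with h1 | ⟨h1, -⟩ <;> rw [h1]
      simp
    · rintro k' x' L he ⟨⟨-, -, hk⟩, hx⟩
      obtain rfl : k' = k := hk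
      obtain rfl : x' = x := hx
      exact hno he
  | byzantine b =>
    obtain ⟨hb, h1, h2, h3⟩ := h.byzantine_eq
    rw [load_byzantine (fun hbW => hQ b hbW hb) h3]
    cases k <;> simp only [Config.log, h1, h2] <;> exact le_rfl
  | receive j i =>
    obtain ⟨hr, hadj⟩ := h.receipt
    cases hr with
    | empty => exact le_rfl
    | forward m rest hch hi =>
      rw [← load_pop hadj hch]
      exact Nat.add_le_add (load_transmit_hop_le hfree j i _ m _) (by cases k <;> exact le_rfl)
    | discard m rest hch =>
      rw [← load_pop hadj hch]
      exact Nat.add_le_add (Nat.le_add_right _ _) (by cases k <;> exact le_rfl)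
    | data m rest hch hi hm =>
      subst hi
      rw [← load_pop hadj hch]
      cases k with
      | ack => exact Nat.add_le_add (Nat.le_add_right _ _) le_rfl
      | data =>
        rw [add_assoc]
        refine Nat.add_le_add_left ?_ _
        have := countP_logWith_le (c := c) (x := x) (Q := Q) (j := j) hm
        rw [add_comm] at this
        refine le_trans ?_ this
        simp only [Config.log, onData_eq]
        by_cases hs : net.Supported .data (c.logWith .data (m.hop j)) (m.hop j).pair
        · rw [if_pos hs]; simp
        · rw [if_neg hs]
    | ack m rest hch hi hm =>
      subst hi
      rw [← load_pop hadj hch]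
      cases k with
      | data => exact Nat.add_le_add (Nat.le_add_right _ _) le_rfl
      | ack =>
        rw [add_assoc]
        refine Nat.add_le_add_left ?_ _
        have := countP_logWith_le (c := c) (x := x) (Q := Q) (j := j) hm
        rw [add_comm] at this
        refine le_trans ?_ this
        simp only [Config.log, onAck_eq]
        exact le_rfl

/-- A supported pair is logged often for a path without Byzantine nodes. -/
theorem Network.Supported.exists_path {impl : PathSelection} (hnet : net.Admissible impl)
    {k : Kind} {q : List P → List (M × ZMod 3)} {x : M × ZMod 3} (h : net.Supported k q x) :
    ∃ Q : List P, (Q ++ [net.dst k]).Nodup ∧ (∀ y ∈ Q ++ [net.dst k], y ∉ net.byzantine) ∧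
      net.FloodedPath (q Q) x := by
  obtain ⟨D, hD, hdis⟩ := h
  -- The f Byzantine nodes spoil at most f of the f + 1 disjoint paths.
  obtain ⟨D', hD'D, hD', hav⟩ := hdis.exists_avoiding net.byzantine (m := 1)
    (Nat.add_le_add_right hnet.card_byzantine 1)
  obtain ⟨l, hl⟩ : D'.Nonempty := Finset.card_pos.1 (by rw [hD'.1]; exact one_pos)
  obtain ⟨Q, hQ, rfl⟩ := hD l (hD'D hl)
  have hp := hD'.2.1 _ hl
  have hsrc : ∀ k, net.src k ∉ net.byzantine := by
    intro k
    cases k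
    · exact Finset.disjoint_left.1 hnet.disjoint hnet.sender_correct
    · exact Finset.disjoint_left.1 hnet.disjoint hnet.receiver_correct
  have hdst : ∀ k, net.dst k ∉ net.byzantine := by
    intro k
    cases k
    exacts [hsrc .ack, hsrc .data]
  refine ⟨Q, hp.1, fun y hy => ?_, hQ⟩
  rcases mem_of_path hp hy with rfl | rfl | h
  · exact hsrc k
  · exact hdst k
  · exact hav _ hl y h

theorem le_countP_of_flooded {q : List (M × ZMod 3)} {x : M × ZMod 3}
    (h : net.FloodedPath q x) :
    net.capacity * Fintype.card P + 1 ≤ q.countP fun y => decide (y = x) := by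
  unfold Network.FloodedPath at h
  rw [← List.take_append_drop (net.capacity * Fintype.card P + 1) q, List.countP_append, h,
    List.countP_replicate]
  simp

theorem FloodedPath.mem {q : List (M × ZMod 3)} {x : M × ZMod 3}
    (h : net.FloodedPath q x) : x ∈ q := by
  have := List.countP_pos_iff.1 ((Nat.succ_pos _).trans_le (le_countP_of_flooded h))
  obtain ⟨y, hy, hx⟩ := this
  rwa [of_decide_eq_true hx] at hy

/-- Support clears the log of data at once, while the log of acknowledgments survives until the next
fetch. The absence of support is therefore demanded for data only. -/
theorem Network.Step.dst_log {c c' : Config P M} {a : Action P} (h : net.Step c a c')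
    {k : Kind} {j : P} {m : Frame P M} {rest : List (Frame P M)}
    (ha : a = .receive j (net.dst k)) (hch : c.channel j (net.dst k) = m :: rest)
    (hm : net.Carries k m) (hno : k = .data → ¬ net.Supports k m.pair c a) :
    c'.log k = c.logWith k (m.hop j) ∧ c'.channel = pop j (net.dst k) rest c.channel := by
  subst ha
  obtain ⟨hr, hadj⟩ := h.receipt
  cases hr with
  | empty h0 => simp [h0] at hch
  | forward m' rest' hch' hi =>
    rw [hch'] at hch
    cases hch
    exact absurd hm.2.1 hi
  | discard m' rest' hch' hi hn =>
    rw [hch'] at hch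
    cases hch
    exact absurd hm (hn k rfl)
  | data m' rest' hch' hi hm' =>
    rw [hch'] at hch
    cases hch
    obtain rfl : .data = k := hm'.2.2.symm.trans hm.2.2
    refine ⟨?_, rfl⟩
    simp only [Config.log, onData_eq]
    rw [if_neg]
    exact fun hs => hno rfl ⟨j, m, rest, rfl, hadj, hch', hm, rfl, hs⟩
  | ack m' rest' hch' hi hm' =>
    rw [hch'] at hch
    cases hch
    obtain rfl : .ack = k := hm'.2.2.symm.trans hm.2.2
    refine ⟨?_, rfl⟩
    simp only [Config.log, onAck_eq]

end Potential

/-! ### Supported pairs have been sent. -/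

section Emission

variable {P M : Type*} [Fintype P] {net : Network P} (R : Execution net M)

/-- In step `t` the pair `x` is sent in messages of type `k`. -/
def Execution.EmitsAt (k : Kind) (t : ℕ) (x : M × ZMod 3) : Prop :=
  net.Emits k x (R.action t) (R.config (t + 1))

/-- In step `t` a message of type `k` is received and its pair `x` is then supported. -/
def Execution.SupportsAt (k : Kind) (t : ℕ) (x : M × ZMod 3) : Prop :=
  net.Supports k x (R.config t) (R.action t)

variable {R}

theorem Execution.potential_le (hne : net.sender ≠ net.receiver) {k : Kind} {x : M × ZMod 3}
    {Q : List P} (hQ : ∀ y ∈ Q ++ [net.dst k], y ∉ net.byzantine) {s t : ℕ} (hst : s ≤ t)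
    (hno : ∀ t', s ≤ t' → t' < t → ¬ R.EmitsAt k t' x) :
    potential net k x Q (R.config t) ≤ potential net k x Q (R.config s) := by
  induction t, hst using Nat.le_induction with
  | base => exact le_rfl
  | succ t hst ih =>
    exact ((R.step t).potential_le hne hQ (hno t hst (Nat.lt_succ_self t))).trans
      (ih fun t' h1 h2 => hno t' h1 (h2.trans (Nat.lt_succ_self t)))

/-- What is supported after the log was empty has been sent since then. -/
theorem Execution.SupportsAt.exists_emitsAt {impl : PathSelection} (hnet : net.Admissible impl)
    {k : Kind} {x : M × ZMod 3} {s t : ℕ} (h : R.SupportsAt k t x) (hst : s ≤ t)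
    (hs : (R.config s).log k = fun _ => []) : ∃ t', s ≤ t' ∧ t' < t ∧ R.EmitsAt k t' x := by
  by_contra hno
  push Not at hno
  obtain ⟨j, m, rest, -, hadj, hch, hm, -, hsup⟩ := h
  obtain ⟨Q, hnd, hQ, hfl⟩ := hsup.exists_path hnet
  -- The received message and the log together give a potential of at least C + 1 at time `t`. At
  -- time `s` the log is empty, so the potential is a load and at most C. Without an emission in
  -- between it cannot have grown.
  have h1 := le_countP_of_flooded hfl
  have h2 := countP_logWith_le (c := R.config t) (x := x) (Q := Q) (j := j) hm
  have h3 := Execution.potential_le hnet.sender_ne_receiver hQ hst hno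
  have h4 := load_pop (W := Q ++ [net.dst k]) (g := fun m => net.Carries k m ∧ m.pair = x)
    hadj hch
  have h5 := load_le (g := fun m => net.Carries k m ∧ m.pair = x) hnet hnd hQ (R.bounded s)
  unfold potential at h3
  rw [hs] at h3
  simp only [List.countP_nil, add_zero] at h3
  omega

end Emission

/-! ### How the states of sender and receiver change in a step. -/

section States

variable {P M : Type*} [Fintype P] {net : Network P}

/-- The payload and label that the sender is sending. -/
def Config.pair (c : Config P M) : M × ZMod 3 := (c.snd.message, c.snd.label)

theorem Network.Step.rcv_of_supports {c c' : Config P M} {a : Action P} (h : net.Step c a c')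
    {x : M × ZMod 3} (hx : net.Supports .data x c a) :
    c'.rcv = { currentLabel := x.2
               acking := some x
               received := fun _ => []
               output := if c.rcv.currentLabel = x.2 then c.rcv.output
                 else c.rcv.output ++ [x.1] } := by
  obtain ⟨j, m, rest, rfl, hadj, hch, hm, rfl, hs⟩ := hx
  obtain ⟨hr, -⟩ := h.receipt
  cases hr with
  | empty h0 => simp [h0] at hch
  | forward m' rest' hch' hi =>
    rw [hch'] at hch
    cases hch
    exact absurd hm.2.1 hi
  | discard m' rest' hch' hi hn =>
    rw [hch'] at hch
    cases hch
    exact absurd hm (hn .data rfl)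
  | data m' rest' hch' hi hm' =>
    rw [hch'] at hch
    cases hch
    simp only [onData_eq]
    exact if_pos hs
  | ack m' rest' hch' hi hm' =>
    rw [hch'] at hch
    cases hch
    exact nomatch hm'.2.2.symm.trans hm.2.2

theorem Network.Step.rcv_cases {c c' : Config P M} {a : Action P} (h : net.Step c a c') :
    (∃ x, net.Supports .data x c a) ∨ c'.rcv.currentLabel = c.rcv.currentLabel ∧
      c'.rcv.acking = c.rcv.acking ∧ c'.rcv.output = c.rcv.output := by
  cases a with
  | timer i =>
    obtain ⟨y, rfl⟩ := h.timer_eq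
    right
    rw [timerStep_rcv]
    exact ⟨rfl, rfl, rfl⟩
  | byzantine b =>
    right
    rw [h.byzantine_eq.2.2.1]
    exact ⟨rfl, rfl, rfl⟩
  | receive j i =>
    obtain ⟨hr, hadj⟩ := h.receipt
    cases hr with
    | empty => exact .inr ⟨rfl, rfl, rfl⟩
    | forward => exact .inr ⟨rfl, rfl, rfl⟩
    | discard => exact .inr ⟨rfl, rfl, rfl⟩
    | ack => exact .inr ⟨rfl, rfl, rfl⟩
    | data m rest hch hi hm =>
      subst hi
      by_cases hs : net.Supported .data (c.logWith .data (m.hop j)) (m.hop j).pair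
      · exact .inl ⟨_, j, m, rest, rfl, hadj, hch, hm, rfl, hs⟩
      · right
        simp only [onData_eq, if_neg hs]
        exact ⟨trivial, trivial, trivial⟩

theorem Network.Step.approved_of_supports {c c' : Config P M} {a : Action P}
    (h : net.Step c a c') {x : M × ZMod 3} (hx : net.Supports .ack x c a) :
    c'.snd.approved = true := by
  obtain ⟨j, m, rest, rfl, hadj, hch, hm, rfl, hs⟩ := hx
  obtain ⟨hr, -⟩ := h.receipt
  cases hr with
  | empty h0 => simp [h0] at hch
  | forward m' rest' hch' hi =>
    rw [hch'] at hch
    cases hch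
    exact absurd hm.2.1 hi
  | discard m' rest' hch' hi hn =>
    rw [hch'] at hch
    cases hch
    exact absurd hm (hn .ack rfl)
  | data m' rest' hch' hi hm' =>
    rw [hch'] at hch
    cases hch
    exact nomatch hm'.2.2.symm.trans hm.2.2
  | ack m' rest' hch' hi hm' =>
    rw [hch'] at hch
    cases hch
    simp only [onAck_eq]
    exact if_pos hs

theorem Network.Step.snd_cases {c c' : Config P M} {a : Action P} (h : net.Step c a c') :
    (a = .timer net.sender ∧ ∃ y, c'.snd = c.snd.prepare y) ∨
      c'.pair = c.pair ∧
      (c'.snd.approved = c.snd.approved ∨ ∃ x, net.Supports .ack x c a) ∧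
      (∀ Q, ∀ e ∈ c'.snd.confirmations Q, e ∈ c.snd.confirmations Q ∨ e.2 = c.snd.label) := by
  cases a with
  | timer i =>
    obtain ⟨y, rfl⟩ := h.timer_eq
    by_cases hi : i = net.sender
    · subst hi
      exact .inl ⟨rfl, y, timerStep_snd net y c⟩
    · right
      unfold Config.pair
      rw [timerStep_snd_of_ne hi]
      exact ⟨rfl, .inl rfl, fun _ _ h => .inl h⟩
  | byzantine b =>
    right
    unfold Config.pair
    rw [h.byzantine_eq.2.1]
    exact ⟨rfl, .inl rfl, fun _ _ h => .inl h⟩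
  | receive j i =>
    right
    obtain ⟨hr, hadj⟩ := h.receipt
    cases hr with
    | empty => exact ⟨rfl, .inl rfl, fun _ _ h => .inl h⟩
    | forward => exact ⟨rfl, .inl rfl, fun _ _ h => .inl h⟩
    | discard => exact ⟨rfl, .inl rfl, fun _ _ h => .inl h⟩
    | data => exact ⟨rfl, .inl rfl, fun _ _ h => .inl h⟩
    | ack m rest hch hi hm =>
      subst hi
      simp only [Config.pair, onAck_eq]
      refine ⟨trivial, ?_, fun Q e he => mem_logWith_ack he⟩
      by_cases hs : net.Supported .ack (c.logWith .ack (m.hop j)) (m.hop j).pair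
      · exact .inr ⟨_, j, m, rest, rfl, hadj, hch, hm, rfl, hs⟩
      · exact .inl (if_neg hs)

end States

/-! ### Counting fetches, and what must happen between two of them. -/

section Fetches

variable {P M : Type*} [Fintype P] {net : Network P} (R : Execution net M)

/-- The number of fetches before step `t`. -/
noncomputable def Execution.fetchesBefore (t : ℕ) : ℕ := Nat.count R.FetchesAt t

variable {R}

theorem Execution.fetchCount_eq (t : ℕ) : R.fetchCount t = R.fetchesBefore (t + 1) := by
  rw [fetchesBefore, Nat.count_eq_card_filter_range, fetchCount]

theorem Execution.FetchesAt.count_succ {t : ℕ} (h : R.FetchesAt t) :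
    R.fetchesBefore (t + 1) = R.fetchesBefore t + 1 := by
  rw [Execution.fetchesBefore, Nat.count_succ, if_pos h, Execution.fetchesBefore]

theorem Execution.count_succ_of_not {t : ℕ} (h : ¬ R.FetchesAt t) :
    R.fetchesBefore (t + 1) = R.fetchesBefore t := by
  rw [Execution.fetchesBefore, Nat.count_succ, if_neg h, Execution.fetchesBefore, add_zero]

theorem Execution.fetchesBefore_mono {s t : ℕ} (h : s ≤ t) :
    R.fetchesBefore s ≤ R.fetchesBefore t := Nat.count_monotone _ h

theorem Execution.not_fetchesAt_of_eq {s t u : ℕ} (h : R.fetchesBefore s = R.fetchesBefore t)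
    (hsu : s ≤ u) (hut : u < t) : ¬ R.FetchesAt u := by
  intro hu
  have h1 := hu.count_succ
  have h2 : R.fetchesBefore (u + 1) ≤ R.fetchesBefore t := fetchesBefore_mono hut
  have h3 : R.fetchesBefore s ≤ R.fetchesBefore u := fetchesBefore_mono hsu
  omega

theorem Execution.fetchesBefore_eq_of_not {s t : ℕ} (hst : s ≤ t)
    (h : ∀ u, s ≤ u → u < t → ¬ R.FetchesAt u) : R.fetchesBefore t = R.fetchesBefore s := by
  induction t, hst using Nat.le_induction with
  | base => rfl
  | succ t hst ih =>
    rw [count_succ_of_not (h t hst (Nat.lt_succ_self t)),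
      ih fun u h1 h2 => h u h1 (h2.trans (Nat.lt_succ_self t))]

theorem Execution.exists_last_fetch {s t : ℕ} (hst : s ≤ t)
    (h : R.fetchesBefore s < R.fetchesBefore t) :
    ∃ u, s ≤ u ∧ u < t ∧ R.FetchesAt u ∧ R.fetchesBefore (u + 1) = R.fetchesBefore t := by
  induction t, hst using Nat.le_induction with
  | base => exact absurd h (lt_irrefl _)
  | succ t hst ih =>
    by_cases ht : R.FetchesAt t
    · exact ⟨t, hst, Nat.lt_succ_self t, ht, rfl⟩
    · rw [count_succ_of_not ht] at h ⊢
      obtain ⟨u, h1, h2, h3⟩ := ih h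
      exact ⟨u, h1, h2.trans (Nat.lt_succ_self t), h3⟩

theorem Execution.FetchesAt.snd_eq {t : ℕ} (h : R.FetchesAt t) :
    ∃ y, (R.config (t + 1)).snd = ⟨y, (R.config t).snd.label + 1, false, fun _ => []⟩ := by
  have hs := R.step t
  rw [h.1] at hs
  obtain ⟨y, hy⟩ := hs.timer_eq
  refine ⟨y, ?_⟩
  rw [hy, timerStep_snd, SenderState.prepare, if_pos h.2]

theorem Execution.snd_cases {t : ℕ} (h : ¬ R.FetchesAt t) :
    (R.config (t + 1)).pair = (R.config t).pair ∧
    ((R.config (t + 1)).snd.approved = (R.config t).snd.approved ∨ ∃ x, R.SupportsAt .ack t x) ∧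
    ∀ Q, ∀ e ∈ (R.config (t + 1)).snd.confirmations Q,
      e ∈ (R.config t).snd.confirmations Q ∨ e.2 = (R.config t).snd.label := by
  rcases (R.step t).snd_cases with ⟨ha, y, hy⟩ | h'
  · have : (R.config (t + 1)).snd = (R.config t).snd := by
      rw [hy, SenderState.prepare, if_neg fun hap => h ⟨ha, hap⟩]
    unfold Config.pair
    rw [this]
    exact ⟨rfl, .inl rfl, fun _ _ h => .inl h⟩
  · exact h'

theorem Execution.pair_eq {s t : ℕ} (hst : s ≤ t)
    (h : R.fetchesBefore s = R.fetchesBefore t) : (R.config t).pair = (R.config s).pair := by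
  have hno : ∀ u, s ≤ u → u < t → ¬ R.FetchesAt u := fun u => not_fetchesAt_of_eq h
  clear h
  induction t, hst using Nat.le_induction with
  | base => rfl
  | succ t hst ih =>
    rw [(snd_cases (hno t hst (Nat.lt_succ_self t))).1,
      ih fun u h1 h2 => hno u h1 (h2.trans (Nat.lt_succ_self t))]

theorem Execution.label_eq (t : ℕ) :
    (R.config t).snd.label = (R.config 0).snd.label + R.fetchesBefore t := by
  induction t with
  | zero => simp [fetchesBefore]
  | succ t ih =>
    by_cases ht : R.FetchesAt t
    · obtain ⟨y, hy⟩ := ht.snd_eq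
      rw [ht.count_succ, hy]
      simp only [ih]
      push_cast
      ring
    · rw [count_succ_of_not ht, ← ih]
      exact congrArg Prod.snd (snd_cases ht).1

/-- The fetch empties the log, and afterwards only acknowledgments with the current label are
recorded. -/
theorem Execution.confirmations_label {s t : ℕ} (hs : R.FetchesAt s) (hst : s < t)
    (h : R.fetchesBefore (s + 1) = R.fetchesBefore t) :
    ∀ Q, ∀ e ∈ (R.config t).snd.confirmations Q, e.2 = (R.config t).snd.label := by
  have hno : ∀ u, s + 1 ≤ u → u < t → ¬ R.FetchesAt u := fun u => not_fetchesAt_of_eq h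
  clear h
  induction t, hst using Nat.le_induction with
  | base =>
    obtain ⟨y, hy⟩ := hs.snd_eq
    rw [hy]
    simp
  | succ t hst ih =>
    obtain ⟨h1, -, h3⟩ := snd_cases (hno t hst (Nat.lt_succ_self t))
    have h4 := congrArg Prod.snd h1
    simp only [Config.pair] at h4
    intro Q e he
    rw [h4]
    rcases h3 Q e he with he | he
    · exact ih (fun u h1 h2 => hno u h1 (h2.trans (Nat.lt_succ_self t))) Q e he
    · exact he

theorem Execution.emitsAt_data {t : ℕ} {x : M × ZMod 3} (h : R.EmitsAt .data t x) :
    x = (R.config (t + 1)).pair := by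
  have := h.2
  simp only [Config.outgoing, Option.some.injEq] at this
  exact this.symm

/-- Between two consecutive fetches the receiver sends an acknowledgment with the current
label. -/
theorem Execution.exists_ack_of_fetches {impl : PathSelection} (hnet : net.Admissible impl)
    {s t : ℕ} (hs : R.FetchesAt s) (ht : R.FetchesAt t) (hst : s < t)
    (h : R.fetchesBefore (s + 1) = R.fetchesBefore t) :
    ∃ u, s < u ∧ u < t ∧ ∃ p, R.EmitsAt .ack u (p, (R.config t).snd.label) := by
  -- The fetch at `s` resets the approval and only a supported acknowledgment can restore it.
  have hflip : ∃ u, s < u ∧ u < t ∧ ∃ x, R.SupportsAt .ack u x := by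
    by_contra hno
    push Not at hno
    have : ∀ u, s + 1 ≤ u → u ≤ t → (R.config u).snd.approved = false := by
      intro u hu
      induction u, hu using Nat.le_induction with
      | base =>
        intro _
        obtain ⟨y, hy⟩ := hs.snd_eq
        rw [hy]
      | succ u hu ih =>
        intro hut
        rcases (snd_cases (not_fetchesAt_of_eq h hu hut)).2.1 with h1 | ⟨x, hx⟩
        · rw [h1]; exact ih (Nat.le_of_succ_le hut)
        · exact absurd hx (hno u hu hut x)
    exact absurd ht.2 (by rw [this t hst le_rfl]; simp)
  obtain ⟨u, hsu, hut, x, hx⟩ := hflip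
  have hFu : R.fetchesBefore u = R.fetchesBefore t := by
    have h1 : R.fetchesBefore (s + 1) ≤ R.fetchesBefore u := fetchesBefore_mono hsu
    have h2 : R.fetchesBefore u ≤ R.fetchesBefore t := fetchesBefore_mono hut.le
    omega
  have hempty : (R.config (s + 1)).log .ack = fun _ => [] := by
    obtain ⟨y, hy⟩ := hs.snd_eq
    simp only [Config.log, hy]
  obtain ⟨u', hu1, hu2, he⟩ := hx.exists_emitsAt hnet hsu hempty
  refine ⟨u', hu1, hu2.trans hut, x.1, ?_⟩
  have hlab : (R.config t).snd.label = (R.config u).snd.label := by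
    rw [label_eq t, label_eq u, hFu]
  obtain ⟨j, m, rest, -, -, -, -, -, hsup⟩ := hx
  obtain ⟨Q, -, -, hfl⟩ := hsup.exists_path hnet
  -- The approval test itself does not compare labels. But a supported pair occurs in the log, and
  -- all entries carry the current label.
  have hx2 : x.2 = (R.config t).snd.label := by
    rw [hlab]
    rcases mem_logWith_ack (FloodedPath.mem hfl) with hm | hm
    · exact confirmations_label hs hsu (h.trans hFu.symm) Q x hm
    · exact hm
  rw [← hx2]
  exact he

theorem Execution.rcv_cases (t : ℕ) :
    (∃ x, R.SupportsAt .data t x) ∨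
      (R.config (t + 1)).rcv.currentLabel = (R.config t).rcv.currentLabel ∧
      (R.config (t + 1)).rcv.acking = (R.config t).rcv.acking ∧
      (R.config (t + 1)).rcv.output = (R.config t).rcv.output :=
  (R.step t).rcv_cases

theorem Execution.SupportsAt.rcv_eq {t : ℕ} {x : M × ZMod 3} (h : R.SupportsAt .data t x) :
    (R.config (t + 1)).rcv = { currentLabel := x.2
                               acking := some x
                               received := fun _ => []
                               output := if (R.config t).rcv.currentLabel = x.2
                                 then (R.config t).rcv.output
                                 else (R.config t).rcv.output ++ [x.1] } :=
  (R.step t).rcv_of_supports h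

/-- Only a supported data message changes what the receiver acknowledges. -/
theorem Execution.exists_supportsAt_of_acking {s t : ℕ} (hst : s ≤ t) {x : M × ZMod 3}
    (hs : (R.config s).rcv.acking ≠ some x) (ht : (R.config t).rcv.acking = some x) :
    ∃ u, s ≤ u ∧ u < t ∧ R.SupportsAt .data u x := by
  induction t, hst using Nat.le_induction with
  | base => exact absurd ht hs
  | succ t hst ih =>
    rcases rcv_cases (R := R) t with ⟨y, hy⟩ | h
    · rw [hy.rcv_eq] at ht
      obtain rfl : y = x := by simpa using ht
      exact ⟨t, hst, Nat.lt_succ_self t, hy⟩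
    · obtain ⟨u, h1, h2, h3⟩ := ih (h.2.1 ▸ ht)
      exact ⟨u, h1, h2.trans (Nat.lt_succ_self t), h3⟩

end Fetches

/-! ### Synchronization of the receiver with the sender. -/

section Synchronization

variable {P M : Type*} [Fintype P] {net : Network P} (R : Execution net M)

/-- At time `t` the receiver acknowledges what the sender sent `d` fetches before, and its log
has been cleared since that was fetched. -/
def Execution.Synced (d t : ℕ) : Prop :=
  ∃ s ≤ t, ((R.config s).log .data = fun _ => []) ∧
    (R.config t).rcv.acking = some (R.config s).pair ∧
    (R.config t).rcv.currentLabel = (R.config s).pair.2 ∧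
    R.fetchesBefore t = R.fetchesBefore s + d

variable {R}

theorem zmod_three_add_one_ne (a : ZMod 3) : a + 1 ≠ a := by
  revert a; decide

theorem Execution.pair_snd (t : ℕ) :
    (R.config t).pair.2 = (R.config 0).snd.label + R.fetchesBefore t := label_eq t

theorem Execution.DeliversAt.output_ne {t : ℕ} {m : M} (h : R.DeliversAt t m) :
    (R.config (t + 1)).rcv.output ≠ (R.config t).rcv.output := by
  rw [h]
  simp

/-- What becomes supported has been sent since time `s`, hence is the pair of time `s` or, if d = 1,
the one fetched after it. The former has the receiver's current label and is not delivered; the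
latter has the next label and is delivered. -/
theorem Execution.Synced.step {impl : PathSelection} (hnet : net.Admissible impl) {d t : ℕ}
    (h : R.Synced d t) (hd : d ≤ 1) (hno : ¬ R.FetchesAt t) :
    (R.Synced d (t + 1) ∧ (R.config (t + 1)).rcv.output = (R.config t).rcv.output) ∨
      d = 1 ∧ R.Synced 0 (t + 1) ∧ R.DeliversAt t (R.config t).pair.1 := by
  obtain ⟨s, hst, hlog, hack, hcur, hF⟩ := h
  have hF' := count_succ_of_not hno
  rcases rcv_cases (R := R) t with ⟨x, hx⟩ | h1
  · obtain ⟨u, hsu, hut, he⟩ := hx.exists_emitsAt hnet hst hlog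
    have hxp := emitsAt_data he
    have h2 : R.fetchesBefore s ≤ R.fetchesBefore (u + 1) := fetchesBefore_mono (by omega)
    have h3 : R.fetchesBefore (u + 1) ≤ R.fetchesBefore t := fetchesBefore_mono hut
    have hrcv := hx.rcv_eq
    by_cases h4 : R.fetchesBefore (u + 1) = R.fetchesBefore s
    · have hxs : x = (R.config s).pair := by
        rw [hxp, pair_eq (by omega : s ≤ u + 1) h4.symm]
      left
      refine ⟨⟨s, by omega, hlog, ?_, ?_, by omega⟩, ?_⟩
      · rw [hrcv, hxs]
      · rw [hrcv, hxs]
      · rw [hrcv]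
        exact if_pos (by rw [hcur, hxs])
    · have h5 : R.fetchesBefore (u + 1) = R.fetchesBefore t := by omega
      have hxt : x = (R.config t).pair := by rw [hxp, pair_eq hut h5]
      have hxt' : x = (R.config (t + 1)).pair := by rw [(snd_cases hno).1, hxt]
      right
      refine ⟨by omega, ⟨t + 1, le_rfl, ?_, ?_, ?_, rfl⟩, ?_⟩
      · simp only [Config.log, hrcv]
      · rw [hrcv, ← hxt']
      · rw [hrcv, ← hxt']
      · unfold DeliversAt
        rw [hrcv, ← hxt]
        refine if_neg ?_
        rw [hcur, hxt, pair_snd, pair_snd, hF, show d = 1 by omega]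
        push_cast
        rw [← add_assoc]
        exact (zmod_three_add_one_ne _).symm
  · left
    exact ⟨⟨s, by omega, hlog, by rw [h1.2.1, hack], by rw [h1.1, hcur], by omega⟩, h1.2.2⟩

theorem Execution.FetchesAt.rcv_eq {t : ℕ} (h : R.FetchesAt t) :
    (R.config (t + 1)).rcv = (R.config t).rcv := by
  have hs := R.step t
  rw [h.1] at hs
  obtain ⟨y, hy⟩ := hs.timer_eq
  rw [hy, timerStep_rcv]

theorem Execution.Synced.fetch {t : ℕ} (h : R.Synced 0 t) (ht : R.FetchesAt t) :
    R.Synced 1 (t + 1) := by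
  obtain ⟨s, hst, hlog, hack, hcur, hF⟩ := h
  have := ht.count_succ
  exact ⟨s, by omega, hlog, by rw [ht.rcv_eq, hack], by rw [ht.rcv_eq, hcur], by omega⟩

theorem Execution.Synced.not_zero {t : ℕ} (h : R.Synced 1 t) : ¬ R.Synced 0 t := by
  rintro ⟨s, hst, -, hack, -, hF⟩
  obtain ⟨s', hst', -, hack', -, hF'⟩ := h
  have h1 : (R.config s).pair.2 = (R.config s').pair.2 := by
    rw [hack, Option.some.injEq] at hack'
    rw [hack']
  rw [pair_snd, pair_snd, show R.fetchesBefore s = R.fetchesBefore s' + 1 by omega] at h1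
  push_cast at h1
  rw [← add_assoc] at h1
  exact zmod_three_add_one_ne _ h1

/-- The sender does not fetch again before the receiver has caught up. -/
theorem Execution.not_fetchesAt_of_synced_one {impl : PathSelection}
    (hnet : net.Admissible impl) {s t : ℕ} (hst : s < t) (hs : R.FetchesAt s)
    (hF : R.fetchesBefore (s + 1) = R.fetchesBefore t)
    (h : ∀ u, s < u → u ≤ t → R.Synced 1 u) : ¬ R.FetchesAt t := by
  intro ht
  -- A fetch would require an acknowledgment with the current label, whereas a receiver that is one
  -- fetch behind acknowledges the preceding label.
  obtain ⟨u, hsu, hut, p, he⟩ := exists_ack_of_fetches hnet hs ht hst hF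
  obtain ⟨v, hv, -, hack, -, hFv⟩ := h (u + 1) (by omega) hut
  have h1 := he.2
  simp only [Config.outgoing] at h1
  rw [hack, Option.some.injEq] at h1
  have h2 := congrArg Prod.snd h1
  have h3 : R.fetchesBefore (s + 1) ≤ R.fetchesBefore (u + 1) := fetchesBefore_mono (by omega)
  have h4 : R.fetchesBefore (u + 1) ≤ R.fetchesBefore t := fetchesBefore_mono hut
  simp only at h2
  rw [pair_snd, label_eq t, show R.fetchesBefore t = R.fetchesBefore v + 1 by omega] at h2
  push_cast at h2
  rw [← add_assoc] at h2
  exact zmod_three_add_one_ne _ h2.symm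

/-- The two phases alternate: a fetch ends phase 0 and a delivery ends phase 1. The second
alternative records the last fetch, after which the receiver has not caught up yet. -/
theorem Execution.Synced.phases {impl : PathSelection} (hnet : net.Admissible impl) {s t : ℕ}
    (h : R.Synced 0 s) (hst : s ≤ t) :
    R.Synced 0 t ∨ ∃ u, s ≤ u ∧ u < t ∧ R.FetchesAt u ∧
      R.fetchesBefore (u + 1) = R.fetchesBefore t ∧ ∀ v, u < v → v ≤ t → R.Synced 1 v := by
  induction t, hst using Nat.le_induction with
  | base => exact .inl h
  | succ t hst ih =>
    rcases ih with ih | ⟨u, hsu, hut, hu, hF, hv⟩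
    · by_cases ht : R.FetchesAt t
      · refine .inr ⟨t, hst, Nat.lt_succ_self t, ht, rfl, fun v h1 h2 => ?_⟩
        obtain rfl : v = t + 1 := by omega
        exact ih.fetch ht
      · rcases ih.step hnet zero_le_one ht with h1 | h1
        · exact .inl h1.1
        · exact absurd h1.1 (by simp)
    · have ht := not_fetchesAt_of_synced_one hnet hut hu hF hv
      rcases (hv t hut le_rfl).step hnet le_rfl ht with h1 | h1
      · refine .inr ⟨u, hsu, by omega, hu, by rw [hF, count_succ_of_not ht], fun v h2 h3 => ?_⟩
        rcases Nat.lt_or_ge t v with h4 | h4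
        · obtain rfl : v = t + 1 := by omega
          exact h1.1
        · exact hv v h2 h4
      · exact .inl h1.2.1

theorem Execution.Synced.zero_of_fetchesAt {impl : PathSelection} (hnet : net.Admissible impl)
    {s t : ℕ} (h : R.Synced 0 s) (hst : s ≤ t) (ht : R.FetchesAt t) : R.Synced 0 t := by
  rcases h.phases hnet hst with h | ⟨u, -, hut, hu, hF, hv⟩
  · exact h
  · exact absurd ht (not_fetchesAt_of_synced_one hnet hut hu hF hv)

theorem Execution.Synced.not_deliversAt {impl : PathSelection} (hnet : net.Admissible impl)
    {t : ℕ} {m : M} (h : R.Synced 0 t) : ¬ R.DeliversAt t m := by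
  intro hd
  by_cases ht : R.FetchesAt t
  · exact hd.output_ne (by rw [ht.rcv_eq])
  · rcases h.step hnet zero_le_one ht with h1 | h1
    · exact hd.output_ne h1.2
    · exact absurd h1.1 (by simp)

theorem Execution.Synced.persists {impl : PathSelection} (hnet : net.Admissible impl) {s t : ℕ}
    (h : R.Synced 0 s) (hst : s ≤ t) (hF : R.fetchesBefore s = R.fetchesBefore t) :
    R.Synced 0 t := by
  rcases h.phases hnet hst with h | ⟨u, hsu, hut, hu, -⟩
  · exact h
  · exact absurd hu (not_fetchesAt_of_eq hF hsu hut)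

/-- A delivery after synchronization concerns the message fetched last. -/
theorem Execution.Synced.of_deliversAt {impl : PathSelection} (hnet : net.Admissible impl)
    {s t : ℕ} (h : R.Synced 0 s) (hst : s ≤ t) {m : M} (hd : R.DeliversAt t m) :
    R.Synced 0 (t + 1) ∧ ∃ u, s ≤ u ∧ u < t ∧ R.SendsAt u m ∧
      R.fetchesBefore (u + 1) = R.fetchesBefore (t + 1) := by
  rcases h.phases hnet hst with h | ⟨u, hsu, hut, hu, hF, hv⟩
  · exact absurd hd (h.not_deliversAt hnet)
  · have ht := not_fetchesAt_of_synced_one hnet hut hu hF hv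
    rcases (hv t hut le_rfl).step hnet le_rfl ht with h1 | ⟨-, h1, h2⟩
    · exact absurd h1.2 hd.output_ne
    · refine ⟨h1, u, hsu, hut, ⟨hu.1, ?_⟩, by rw [hF, count_succ_of_not ht]⟩
      have h3 := h2.symm.trans hd
      have h4 : (R.config t).pair.1 = m := by simpa using h3
      rw [← h4, pair_eq hut hF]
      rfl

/-- The first delivery restores phase 0, which lasts until the next fetch and contains no delivery.
-/
theorem Execution.Synced.delivers_once {impl : PathSelection} (hnet : net.Admissible impl)
    {s t t' : ℕ} (h : R.Synced 0 s) (hst : s ≤ t) (htt' : t < t') {m m' : M}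
    (hd : R.DeliversAt t m) (hd' : R.DeliversAt t' m') :
    R.fetchesBefore (t + 1) ≠ R.fetchesBefore (t' + 1) := by
  intro hF
  have h1 : R.fetchesBefore (t + 1) ≤ R.fetchesBefore t' := fetchesBefore_mono htt'
  have h2 : R.fetchesBefore t' ≤ R.fetchesBefore (t' + 1) := fetchesBefore_mono (by omega)
  have h3 := ((h.of_deliversAt hnet hst hd).1).persists hnet htt' (by omega)
  exact h3.not_deliversAt hnet hd'

/-- Without a delivery of this message phase 1 would persist, and the two phases exclude each other
by their labels. -/
theorem Execution.Synced.exists_deliversAt {impl : PathSelection} (hnet : net.Admissible impl)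
    {s t : ℕ} (hs : R.Synced 1 s) (ht : R.Synced 0 t) (hst : s ≤ t)
    (hF : R.fetchesBefore s = R.fetchesBefore t) :
    ∃ u, s ≤ u ∧ u < t ∧ R.DeliversAt u (R.config s).pair.1 := by
  by_contra hno
  push Not at hno
  have key : ∀ u, s ≤ u → u ≤ t → R.Synced 1 u := by
    intro u hu
    induction u, hu using Nat.le_induction with
    | base => exact fun _ => hs
    | succ u hu ih =>
      intro hut
      rcases (ih (by omega)).step hnet le_rfl (not_fetchesAt_of_eq hF hu hut) with h1 | h1
      · exact h1.1
      · refine absurd ?_ (hno u hu hut)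
        have h2 : R.fetchesBefore s ≤ R.fetchesBefore u := fetchesBefore_mono hu
        have h3 : R.fetchesBefore u ≤ R.fetchesBefore t := fetchesBefore_mono (by omega)
        rw [← pair_eq hu (by omega)]
        exact h1.2.2
  exact (key t hst le_rfl).not_zero ht

theorem Execution.approved_of_not_fetchesAt {s t : ℕ} (hst : s ≤ t)
    (hs : (R.config s).snd.approved = true) (hno : ∀ u, s ≤ u → u < t → ¬ R.FetchesAt u) :
    (R.config t).snd.approved = true := by
  induction t, hst using Nat.le_induction with
  | base => exact hs
  | succ t hst ih =>
    rcases (snd_cases (hno t hst (Nat.lt_succ_self t))).2.1 with h | ⟨x, hx⟩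
    · rw [h]
      exact ih fun u h1 h2 => hno u h1 (h2.trans (Nat.lt_succ_self t))
    · exact (R.step t).approved_of_supports hx

/-- What is sent after synchronization is delivered before the next fetch. -/
theorem Execution.Synced.exists_deliversAt_of_sendsAt {impl : PathSelection}
    (hnet : net.Admissible impl) {s t : ℕ} (h : R.Synced 0 s)
    (happ : (R.config s).snd.approved = true) (hlive : ∀ t, ∃ t' ≥ t, R.FetchesAt t')
    (hst : s ≤ t) {m : M} (hm : R.SendsAt t m) :
    ∃ t', s ≤ t' ∧ R.DeliversAt t' m ∧ R.fetchesBefore (t' + 1) = R.fetchesBefore (t + 1) := by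
  -- The approval at time `s` makes the first timer step of the sender a fetch, so nothing fetched
  -- before `s` is sent from then on.
  have hlt : R.fetchesBefore s < R.fetchesBefore (t + 1) := by
    by_contra hle
    have h1 : R.fetchesBefore s ≤ R.fetchesBefore (t + 1) := fetchesBefore_mono (by omega)
    have h2 : R.fetchesBefore s = R.fetchesBefore (t + 1) := by omega
    have h3 : ∀ u, s ≤ u → u < t + 1 → ¬ R.FetchesAt u := fun u => not_fetchesAt_of_eq h2
    exact h3 t hst (Nat.lt_succ_self t)
      ⟨hm.1, approved_of_not_fetchesAt hst happ fun u h4 h5 => h3 u h4 (by omega)⟩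
  obtain ⟨u, hsu, hut, hu, hF⟩ := exists_last_fetch (by omega) hlt
  have hu1 := (h.zero_of_fetchesAt hnet hsu hu).fetch hu
  have hex := hlive (t + 1)
  obtain ⟨hw1, hw2⟩ := Nat.find_spec hex
  have hwmin : ∀ v, t + 1 ≤ v → v < Nat.find hex → ¬ R.FetchesAt v := fun v h1 h2 h3 =>
    Nat.find_min hex h2 ⟨h1, h3⟩
  generalize Nat.find hex = w at hw1 hw2 hwmin
  have hFw : R.fetchesBefore w = R.fetchesBefore (t + 1) := fetchesBefore_eq_of_not hw1 hwmin
  -- Phase 1 holds right after the fetch at `u` and phase 0 at the next fetch `w`, so the delivery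
  -- lies between them.
  obtain ⟨v, huv, hvw, hv⟩ := hu1.exists_deliversAt hnet
    (h.zero_of_fetchesAt hnet (by omega) hw2) (by omega) (by omega)
  refine ⟨v, by omega, ?_, ?_⟩
  · rw [← hm.2]
    rw [← pair_eq (by omega : u + 1 ≤ t + 1) hF] at hv
    exact hv
  · have h1 : R.fetchesBefore (u + 1) ≤ R.fetchesBefore (v + 1) := fetchesBefore_mono (by omega)
    have h2 : R.fetchesBefore (v + 1) ≤ R.fetchesBefore w := fetchesBefore_mono hvw
    omega

/-- After three fetches the receiver has caught up with the sender at the next fetch. -/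
theorem Execution.synced_of_fetches {impl : PathSelection} (hnet : net.Admissible impl)
    {t₁ t₂ t₃ t₄ : ℕ} (h₁ : R.FetchesAt t₁) (h₂ : R.FetchesAt t₂) (h₃ : R.FetchesAt t₃)
    (h₄ : R.FetchesAt t₄) (h₁₂ : t₁ < t₂) (h₂₃ : t₂ < t₃) (h₃₄ : t₃ < t₄)
    (hF₁ : R.fetchesBefore (t₁ + 1) = R.fetchesBefore t₂)
    (hF₂ : R.fetchesBefore (t₂ + 1) = R.fetchesBefore t₃)
    (hF₃ : R.fetchesBefore (t₃ + 1) = R.fetchesBefore t₄) : R.Synced 0 t₄ := by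
  -- Three consecutive labels are acknowledged. They make the acknowledged pair change at `s₂` and
  -- at `s₃`.
  obtain ⟨u₁, hu₁, hu₁', p₁, he₁⟩ := exists_ack_of_fetches hnet h₁ h₂ h₁₂ hF₁
  obtain ⟨u₂, hu₂, hu₂', p₂, he₂⟩ := exists_ack_of_fetches hnet h₂ h₃ h₂₃ hF₂
  obtain ⟨u₃, hu₃, hu₃', p₃, he₃⟩ := exists_ack_of_fetches hnet h₃ h₄ h₃₄ hF₃
  have hc₁ := h₁.count_succ
  have hc₂ := h₂.count_succ
  have hc₃ := h₃.count_succ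
  have ha₁ : (R.config (u₁ + 1)).rcv.acking = some (p₁, (R.config t₂).snd.label) := he₁.2
  have ha₂ : (R.config (u₂ + 1)).rcv.acking = some (p₂, (R.config t₃).snd.label) := he₂.2
  have ha₃ : (R.config (u₃ + 1)).rcv.acking = some (p₃, (R.config t₄).snd.label) := he₃.2
  have hl₂ : (R.config t₃).snd.label = (R.config t₂).snd.label + 1 := by
    rw [label_eq t₃, label_eq t₂, ← hF₂, hc₂]; push_cast; ring
  have hl₃ : (R.config t₄).snd.label = (R.config t₃).snd.label + 1 := by
    rw [label_eq t₃, label_eq t₄, ← hF₃, hc₃]; push_cast; ring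
  obtain ⟨s₂, hs₂, hs₂', hsup₂⟩ := exists_supportsAt_of_acking (s := u₁ + 1) (t := u₂ + 1)
    (by omega) (by
    rw [ha₁, hl₂]
    intro h
    simp only [Option.some.injEq, Prod.mk.injEq] at h
    exact zmod_three_add_one_ne _ h.2.symm) ha₂
  obtain ⟨s₃, hs₃, hs₃', hsup₃⟩ := exists_supportsAt_of_acking (s := u₂ + 1) (t := u₃ + 1)
    (by omega) (by
    rw [ha₂, hl₃]
    intro h
    simp only [Option.some.injEq, Prod.mk.injEq] at h
    exact zmod_three_add_one_ne _ h.2.symm) ha₃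
  -- The first change serves only to empty the log at a time after `t₁`. Thereby the pair supported
  -- at `s₃` must have been sent after `t₁`.
  have hlog : (R.config (s₂ + 1)).log .data = fun _ => [] := by
    simp only [Config.log, hsup₂.rcv_eq]
  obtain ⟨v, hv, hv', hev⟩ := hsup₃.exists_emitsAt hnet (by omega) hlog
  have hx := emitsAt_data hev
  have hxl := congrArg Prod.snd hx
  simp only at hxl
  rw [label_eq t₄, pair_snd] at hxl
  have hcast := add_left_cancel hxl
  have hm1 : R.fetchesBefore (t₁ + 1) ≤ R.fetchesBefore (v + 1) := fetchesBefore_mono (by omega)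
  have hm2 : R.fetchesBefore (v + 1) ≤ R.fetchesBefore (s₃ + 1) := fetchesBefore_mono (by omega)
  have hm3 : R.fetchesBefore (s₃ + 1) ≤ R.fetchesBefore t₄ := fetchesBefore_mono (by omega)
  -- Between `t₁ + 1` and `t₄` the fetch counter takes just three consecutive values, and these are
  -- distinct modulo 3. Equal labels therefore mean equal counts.
  have hmod := (ZMod.natCast_eq_natCast_iff _ _ _).1 hcast
  have hFv : R.fetchesBefore (v + 1) = R.fetchesBefore t₄ := by
    unfold Nat.ModEq at hmod
    omega
  have hxs : (p₃, (R.config t₄).snd.label) = (R.config (s₃ + 1)).pair := by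
    rw [hx]
    exact (pair_eq (by omega) (by omega)).symm
  have hsync : R.Synced 0 (s₃ + 1) := by
    refine ⟨s₃ + 1, le_rfl, ?_, ?_, ?_, rfl⟩
    · simp only [Config.log, hsup₃.rcv_eq]
    · rw [← hxs, hsup₃.rcv_eq]
    · rw [← hxs, hsup₃.rcv_eq]
  exact hsync.persists hnet (by omega) (by omega)

end Synchronization

/-! ### How old messages leave the channels of a route. -/

section Channels

variable {P M : Type*} {net : Network P}

theorem foldl_transmit_channel (i d : P) (l : ZMod 3) (k : Kind) (y : M) (u v : P)
    (Ls : List (List P)) (ch : P → P → List (Frame P M)) :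
    ∃ new, (Ls.foldl (fun ch L => net.transmit i (nextHop i L) ⟨i, d, [], L, l, k, y⟩ ch) ch) u v
      = ch u v ++ new ∧ ∀ m ∈ new, ∃ L, m = ⟨i, d, [], L, l, k, y⟩ := by
  induction Ls generalizing ch with
  | nil => exact ⟨[], by simp⟩
  | cons L Ls ih =>
    obtain ⟨new, h1, h2⟩ := ih (net.transmit i (nextHop i L) ⟨i, d, [], L, l, k, y⟩ ch)
    rw [List.foldl_cons, h1]
    unfold Network.transmit
    split_ifs
    · refine ⟨⟨i, d, [], L, l, k, y⟩ :: new, by simp, fun m hm => ?_⟩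
      rcases List.mem_cons.1 hm with rfl | hm
      exacts [⟨L, rfl⟩, h2 m hm]
    · exact ⟨new, rfl, h2⟩

theorem pop_eq {j i : P} {m : Frame P M} {rest : List (Frame P M)}
    {ch : P → P → List (Frame P M)} (h : ch j i = m :: rest) (u v : P) :
    pop j i rest ch u v =
      if Action.receive j i = .receive u v then (ch u v).tail else ch u v := by
  unfold pop
  by_cases huv : u = j ∧ v = i
  · obtain ⟨rfl, rfl⟩ := huv
    simp [h]
  · have : ¬ (Action.receive j i = .receive u v) := by
      rintro ⟨⟩
      exact huv ⟨rfl, rfl⟩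
    rw [if_neg huv, if_neg this]

theorem OnRoute.left_mem {W : List P} {g : Frame P M → Prop} {u v : P} {m : Frame P M}
    (h : OnRoute W g u v m) : u ∈ W := h.2.subset (by simp)

theorem OnRoute.right_mem {W : List P} {g : Frame P M → Prop} {u v : P} {m : Frame P M}
    (h : OnRoute W g u v m) : v ∈ W := h.2.subset (by simp)

variable [Fintype P]

/-- How the content of a channel changes in a step in which no message with property `g`
originates. -/
theorem Network.Step.channel_cases (hne : net.sender ≠ net.receiver) {c c' : Config P M}
    {a : Action P} (h : net.Step c a c') {W : List P} {g : Frame P M → Prop}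
    (hg : VisitedFree g)
    (hno : ∀ k x L, net.Emits k x a c' → ¬ g ⟨net.src k, net.dst k, [], L, x.2, k, x.1⟩)
    {u v : P} (hu : u ∉ net.byzantine) (hv : v ∉ net.byzantine) :
    ∃ new, c'.channel u v =
        (if a = .receive u v then (c.channel u v).tail else c.channel u v) ++ new ∧
      ∀ m ∈ new, OnRoute W g u v m → ∃ j, ∃ m' ∈ c.channel j u, net.graph.Adj j u ∧
        OnRoute W g j u m' ∧ m.visited.length = m'.visited.length + 1 := by
  cases a with
  | timer i =>
    obtain ⟨y, rfl⟩ := h.timer_eq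
    rw [if_neg (by simp)]
    by_cases hi : ∃ k, i = net.src k
    · obtain ⟨k, rfl⟩ := hi
      rw [timerStep_channel hne]
      rcases ho : (net.timerStep (net.src k) y c).outgoing k with _ | x
      · exact ⟨[], by simp⟩
      · obtain ⟨new, h1, h2⟩ := foldl_transmit_channel (net := net) (net.src k) (net.dst k) x.2 k
          x.1 u v (net.paths (net.src k) (net.dst k)).toList c.channel
        refine ⟨new, h1, fun m hm hr => ?_⟩
        obtain ⟨L, rfl⟩ := h2 m hm
        exact absurd hr.1 (hno k x L ⟨rfl, ho⟩)
    · push Not at hi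
      rw [timerStep_of_ne hi]
      exact ⟨[], by simp⟩
  | byzantine b =>
    obtain ⟨hb, -, -, h3⟩ := h.byzantine_eq
    rw [if_neg (by simp), h3 u v (fun h => hu (h ▸ hb)) (fun h => hv (h ▸ hb))]
    exact ⟨[], by simp⟩
  | receive j i =>
    obtain ⟨hr, hadj⟩ := h.receipt
    cases hr with
    | empty h0 =>
      refine ⟨[], ?_, by simp⟩
      rw [List.append_nil]
      split_ifs with he
      · cases he
        simp [h0]
      · rfl
    | forward m rest hch hi =>
      simp only [Network.transmit]
      split_ifs with h1 h2 h2
      -- The receiver of a message cannot send it into the channel that it came from, as the graph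
      -- has no loops.
      · cases h2
        exact absurd h1.1 hadj.ne
      · rw [pop_eq hch, if_neg h2]
        refine ⟨_, rfl, fun m' hm' hro => ?_⟩
        obtain rfl := List.mem_singleton.1 hm'
        obtain ⟨rfl, -, -⟩ := h1
        exact ⟨j, m, by simp [hch], hadj, hro.of_hop hg, by simp [Frame.hop]⟩
      · rw [pop_eq hch, if_pos h2]
        exact ⟨[], by simp⟩
      · rw [pop_eq hch, if_neg h2]
        exact ⟨[], by simp⟩
    | discard m rest hch => exact ⟨[], by simp [pop_eq hch]⟩
    | data m rest hch => exact ⟨[], by simp [pop_eq hch]⟩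
    | ack m rest hch => exact ⟨[], by simp [pop_eq hch]⟩

/-- All messages with property `g` on the route `W` have visited at least `i` nodes. -/
def ClearBelow (net : Network P) (W : List P) (g : Frame P M → Prop) (i : ℕ)
    (c : Config P M) : Prop :=
  ∀ u v, net.graph.Adj u v → ∀ m ∈ c.channel u v, OnRoute W g u v m → i ≤ m.visited.length

/-- Forwarding lengthens the visited list by one, and no message with property `g` originates in
this step. -/
theorem ClearBelow.step (hne : net.sender ≠ net.receiver) {c c' : Config P M}
    {a : Action P} (h : net.Step c a c') {W : List P} (hW : ∀ y ∈ W, y ∉ net.byzantine)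
    {g : Frame P M → Prop} (hg : VisitedFree g)
    (hno : ∀ k x L, net.Emits k x a c' → ¬ g ⟨net.src k, net.dst k, [], L, x.2, k, x.1⟩)
    {i : ℕ} (hc : ClearBelow net W g i c) : ClearBelow net W g i c' := by
  intro u v huv m hm hr
  obtain ⟨new, h1, h2⟩ := h.channel_cases (W := W) hne hg hno (hW u hr.left_mem)
    (hW v hr.right_mem)
  rw [h1, List.mem_append] at hm
  rcases hm with hm | hm
  · refine hc u v huv m ?_ hr
    split_ifs at hm
    · exact List.mem_of_mem_tail hm
    · exact hm
  · obtain ⟨j, m', hm', hadj, hr', hlen⟩ := h2 m hm hr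
    have := hc j u hadj m' hm' hr'
    omega

/-- All messages with property `g` on the route `W` in the channel from `u` to `v` that have
visited at most `i` nodes are among the `r` oldest ones. -/
def ClearBeyond (W : List P) (g : Frame P M → Prop) (i r : ℕ) (u v : P)
    (c : Config P M) : Prop :=
  ∀ m ∈ (c.channel u v).drop r, OnRoute W g u v m → i < m.visited.length

/-- Messages are appended behind the old ones. By `ClearBelow` a newcomer has visited at least `i`
nodes before its last hop, hence more than `i` now. A receipt from the channel removes one of the
old ones. -/
theorem ClearBeyond.step (hne : net.sender ≠ net.receiver) {c c' : Config P M}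
    {a : Action P} (h : net.Step c a c') {W : List P}
    {g : Frame P M → Prop} (hg : VisitedFree g)
    (hno : ∀ k x L, net.Emits k x a c' → ¬ g ⟨net.src k, net.dst k, [], L, x.2, k, x.1⟩)
    {i : ℕ} (hc : ClearBelow net W g i c) {u v : P}
    (hu : u ∉ net.byzantine) (hv : v ∉ net.byzantine) {r r' : ℕ}
    (hb : ClearBeyond W g i r u v c) (hr : r ≤ r' + if a = .receive u v then 1 else 0) :
    ClearBeyond W g i r' u v c' := by
  intro m hm hro
  obtain ⟨new, h1, h2⟩ := h.channel_cases (W := W) hne hg hno hu hv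
  rw [h1, List.drop_append, List.mem_append] at hm
  rcases hm with hm | hm
  · refine hb m ?_ hro
    split_ifs at hm hr
    · rw [← List.drop_one, List.drop_drop] at hm
      exact List.drop_subset_drop_left _ (by omega) hm
    · exact List.drop_subset_drop_left _ (by omega) hm
  · obtain ⟨j, m', hm', hadj, hr', hlen⟩ := h2 m (List.mem_of_mem_drop hm) hro
    have := hc j u hadj m' hm' hr'
    omega

end Channels

/-! ### Correct routes lose no messages. -/

section Throughput

variable {P M : Type*} [Fintype P] {net : Network P}

theorem Network.Admissible.src_correct {impl : PathSelection} (hnet : net.Admissible impl)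
    (k : Kind) : net.src k ∈ net.correct := by
  cases k
  exacts [hnet.sender_correct, hnet.receiver_correct]

theorem Network.Admissible.dst_correct {impl : PathSelection} (hnet : net.Admissible impl)
    (k : Kind) : net.dst k ∈ net.correct := by
  cases k
  exacts [hnet.receiver_correct, hnet.sender_correct]

theorem Network.Admissible.not_byzantine {impl : PathSelection} (hnet : net.Admissible impl)
    {u : P} (hu : u ∈ net.correct) : u ∉ net.byzantine :=
  Finset.disjoint_left.1 hnet.disjoint hu

/-- A step with action `a` from `c` does not clear the log of type `k`. -/
def Network.Keeps (net : Network P) (k : Kind) (c : Config P M) (a : Action P) : Prop :=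
  match k with
  | .data => ∀ y, ¬ net.Supports .data y c a
  | .ack => ¬ (a = .timer net.sender ∧ c.snd.approved = true)

/-- Either the log of type `k` stays as it is or a message is received. -/
theorem Network.Step.log_cases {c c' : Config P M}
    {a : Action P} (h : net.Step c a c') {k : Kind} (hk : net.Keeps k c a) :
    c'.log k = c.log k ∨ ∃ j m rest, a = .receive j (net.dst k) ∧
      net.graph.Adj j (net.dst k) ∧ c.channel j (net.dst k) = m :: rest ∧ net.Carries k m ∧
      c'.log k = c.logWith k (m.hop j) := by
  cases a with
  | timer i =>
    obtain ⟨y, rfl⟩ := h.timer_eq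
    rcases log_timerStep net i y c k with h1 | ⟨-, rfl, rfl, h1⟩
    · exact .inl h1
    · exact absurd ⟨rfl, h1⟩ hk
  | byzantine b =>
    obtain ⟨-, h1, h2, -⟩ := h.byzantine_eq
    left
    cases k <;> simp only [Config.log, h1, h2]
  | receive j i =>
    by_cases hex : ∃ m rest, i = net.dst k ∧ c.channel j i = m :: rest ∧ net.Carries k m
    · obtain ⟨m, rest, rfl, hch, hm⟩ := hex
      refine .inr ⟨j, m, rest, rfl, h.receipt.2, hch, hm, (h.dst_log rfl hch hm ?_).1⟩
      rintro rfl
      exact hk _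
    · left
      obtain ⟨hr, hadj⟩ := h.receipt
      cases hr with
      | empty => rfl
      | forward => cases k <;> rfl
      | discard => cases k <;> rfl
      | data m rest hch hi hm =>
        cases k with
        | data => exact absurd ⟨m, rest, hi, hch, hm⟩ hex
        | ack => rfl
      | ack m rest hch hi hm =>
        cases k with
        | ack => exact absurd ⟨m, rest, hi, hch, hm⟩ hex
        | data => rfl

/-- While the log is not cleared, the origin `src k` increases the number of messages on a
correct path and of entries for it. -/
theorem Network.Step.throughput (hne : net.sender ≠ net.receiver) {c c' : Config P M}
    {a : Action P} (h : net.Step c a c') {k : Kind} {x : M × ZMod 3} {Q W : List P}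
    (hW : W = Q ++ [net.dst k])
    (hp : IsPath net.graph (net.src k) (net.dst k) W)
    (hWb : ∀ y ∈ W, y ∉ net.byzantine) (hsel : W ∈ net.paths (net.src k) (net.dst k))
    (hout : a = .timer (net.src k) → c'.outgoing k = some x) (hk : net.Keeps k c a)
    (hacc : c.Accepts k x.2) :
    load net W (fun m => net.Carries k m ∧ m.pair = x ∧ m.intended = W) c.channel +
        (c.log k Q).length + (if a = .timer (net.src k) then 1 else 0) ≤
      load net W (fun m => net.Carries k m ∧ m.pair = x ∧ m.intended = W) c'.channel +
        (c'.log k Q).length := by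
  have hlog : (c.log k Q).length ≤ (c'.log k Q).length := by
    rcases h.log_cases hk with h1 | ⟨j, m, rest, -, -, -, -, h1⟩
    · rw [h1]
    · rw [h1]
      unfold Config.logWith enqueue
      split_ifs
      · dsimp only
        split_ifs <;> simp
      · exact le_rfl
  cases a with
  | timer i =>
    obtain ⟨y, hc'⟩ := h.timer_eq
    by_cases hi : i = net.src k
    · subst hi
      rw [if_pos rfl, add_right_comm]
      refine Nat.add_le_add ?_ hlog
      have h1 := hout rfl
      rw [hc'] at h1 ⊢
      rw [timerStep_channel hne, h1]
      obtain ⟨w, l', hWl⟩ := hp.exists_eq_cons_cons (src_ne_dst hne k)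
      have hnext : nextHop (net.src k) W = some w := by
        rw [hWl]
        exact nextHop_eq_some (A := []) (by rw [List.nil_append, ← hWl]; exact hp.1)
      have hadj : net.graph.Adj (net.src k) w := by
        have := hp.2.1
        rw [hWl, List.isChain_cons_cons] at this
        exact this.1
      exact load_lt_load_faultTolerantSend hsel hnext hadj
        ⟨⟨⟨rfl, rfl, rfl⟩, rfl, rfl⟩, ⟨l', by rw [hWl]; rfl⟩⟩
    · rw [if_neg (by simpa using hi), add_zero]
      refine Nat.add_le_add ?_ hlog
      rw [hc']
      by_cases hi : ∃ k, i = net.src k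
      · obtain ⟨k', rfl⟩ := hi
        rw [timerStep_channel hne]
        rcases (net.timerStep (net.src k') y c).outgoing k' with _ | x
        · exact le_rfl
        · exact load_le_load_foldl _
      · push Not at hi
        rw [timerStep_of_ne hi]
  | byzantine b =>
    obtain ⟨hb, -, -, h3⟩ := h.byzantine_eq
    rw [if_neg (by simp), add_zero, load_byzantine (fun hbW => hWb b hbW hb) h3]
    exact Nat.add_le_add_left hlog _
  | receive j i =>
    rw [if_neg (by simp), add_zero]
    by_cases hex : ∃ m rest, i = net.dst k ∧ c.channel j i = m :: rest ∧ net.Carries k m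
    · obtain ⟨m, rest, rfl, hch, hm⟩ := hex
      have hadj := h.receipt.2
      obtain ⟨h1, h2⟩ := h.dst_log rfl hch hm (by rintro rfl; exact hk _)
      rw [h2, ← load_pop hadj hch, add_assoc]
      refine Nat.add_le_add_left ?_ _
      split_ifs with hr
      · have hQ : m.visited ++ [j] = Q := by
          refine eq_of_prefix_concat (b := net.dst k) (by rw [← hW]; exact hp.1) ?_
          rw [← hW]
          simpa using hr.2
        have hl : (m.hop j).label = x.2 := by
          have := congrArg Prod.snd hr.1.2.1
          exact this
        rw [h1, Config.logWith, if_pos (by rw [hl]; exact hacc), enqueue,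
          show Q = (m.hop j).visited from hQ.symm, if_pos rfl, List.length_cons, add_comm]
      · rw [zero_add]; exact hlog
    · obtain ⟨hr, hadj⟩ := h.receipt
      cases hr with
      | empty => exact le_rfl
      | forward m rest hch hi =>
        refine Nat.add_le_add ?_ hlog
        rw [← load_pop hadj hch]
        split_ifs with hr
        · obtain ⟨⟨hm, hx, hint⟩, s, hs⟩ := id hr
          -- An empty rest would place the relay `i` at the destination. Otherwise the intended path
          -- sends the message to the next node of `W`.
          rcases s with _ | ⟨v, s⟩
          · exfalso
            rw [hW] at hs
            have h2 : (m.visited ++ [j]) ++ [i] = Q ++ [net.dst k] := by simpa using hs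
            have h3 := (List.append_inj' h2 rfl).2
            simp only [List.cons.injEq, and_true] at h3
            exact hi (hm.2.1.trans h3.symm)
          · have hWs : W = (m.visited ++ [j]) ++ i :: v :: s := by rw [← hs]; simp
            have hnext : nextHop i m.intended = some v := by
              rw [hint, hWs]
              exact nextHop_eq_some (by rw [← hWs]; exact hp.1)
            have hiv : net.graph.Adj i v := by
              have := hp.2.1
              rw [hWs] at this
              exact (List.isChain_cons_cons.1 this.right_of_append).1
            simp only [hnext]
            rw [load_transmit hiv, if_pos]
            refine ⟨⟨hm, hx, hint⟩, s, ?_⟩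
            rw [hWs]
            simp [Frame.hop]
        · rw [add_zero]
          exact load_le_load_transmit _ _ _
      | discard m rest hch hi hn =>
        refine Nat.add_le_add ?_ hlog
        rw [← load_pop hadj hch, if_neg, add_zero]
        intro hr
        exact hn k (hi.symm.trans hr.1.1.2.1) hr.1.1
      | data m rest hch hi hm =>
        refine Nat.add_le_add ?_ hlog
        rw [← load_pop hadj hch, if_neg, add_zero]
        intro hr
        exact hex ⟨m, rest, hi.trans (hm.2.1.symm.trans hr.1.1.2.1), hch, hr.1.1⟩
      | ack m rest hch hi hm =>
        refine Nat.add_le_add ?_ hlog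
        rw [← load_pop hadj hch, if_neg, add_zero]
        intro hr
        exact hex ⟨m, rest, hi.trans (hm.2.1.symm.trans hr.1.1.2.1), hch, hr.1.1⟩

end Throughput

/-! ### Asynchronous rounds: flushing stale messages and filling the logs. -/

section Rounds

variable {P M : Type*} [Fintype P] {net : Network P} {R : Execution net M}

theorem Execution.Fair.exists_covers (hR : R.Fair) (a : ℕ) : ∃ b, R.Covers a b := by
  have h : ∀ i ∈ net.correct, ∃ b, (∃ t, a ≤ t ∧ t < b ∧ R.action t = .timer i) ∧
      ∀ j, net.graph.Adj j i → ∃ t, a ≤ t ∧ t < b ∧ R.action t = .receive j i := by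
    intro i hi
    obtain ⟨h1, h2⟩ := hR i hi
    obtain ⟨t, ht, hta⟩ := h1 a
    have h3 : ∀ j, ∃ s, net.graph.Adj j i → a ≤ s ∧ R.action s = .receive j i := by
      intro j
      by_cases hj : net.graph.Adj j i
      · obtain ⟨s, hs, hsa⟩ := h2 j hj a
        exact ⟨s, fun _ => ⟨hs, hsa⟩⟩
      · exact ⟨0, fun h => absurd h hj⟩
    choose s hs using h3
    refine ⟨t + Finset.univ.sup s + 1, ⟨t, ht, by omega, hta⟩, fun j hj => ⟨s j, (hs j hj).1, ?_,
      (hs j hj).2⟩⟩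
    have : s j ≤ Finset.univ.sup s := Finset.le_sup (Finset.mem_univ j)
    omega
  choose! b hb using h
  refine ⟨net.correct.sup b, fun i hi => ?_⟩
  have hle : b i ≤ net.correct.sup b := Finset.le_sup hi
  obtain ⟨⟨t, h1, h2, h3⟩, h4⟩ := hb i hi
  refine ⟨⟨t, h1, h2.trans_le hle, h3⟩, fun j hj => ?_⟩
  obtain ⟨s, h5, h6, h7⟩ := h4 j hj
  exact ⟨s, h5, h6.trans_le hle, h7⟩

/-- Fairness makes the set in `roundEnd` nonempty; the infimum of the empty set would be the
meaningless value 0. -/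
theorem Execution.Fair.covers (hR : R.Fair) (k : ℕ) :
    R.Covers (R.roundEnd k) (R.roundEnd (k + 1)) :=
  Nat.sInf_mem (hR.exists_covers (R.roundEnd k))

theorem Execution.Fair.exists_timer (hR : R.Fair) {i : P} (hi : i ∈ net.correct) (k : ℕ) :
    ∃ t, R.roundEnd k ≤ t ∧ t < R.roundEnd (k + 1) ∧ R.action t = .timer i :=
  (hR.covers k i hi).1

theorem Execution.Fair.roundEnd_mono {impl : PathSelection} (hnet : net.Admissible impl)
    (hR : R.Fair) : Monotone R.roundEnd := by
  refine monotone_nat_of_le_succ fun k => ?_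
  obtain ⟨t, h1, h2, -⟩ := hR.exists_timer hnet.sender_correct k
  omega

/-- In the steps `s, …, e - 1` nothing but `x` is sent in messages of type `k`. -/
def Execution.EmitsOnly (R : Execution net M) (k : Kind) (x : M × ZMod 3) (s e : ℕ) : Prop :=
  ∀ t, s ≤ t → t < e → ∀ y, R.EmitsAt k t y → y = x

/-- The messages of type `k` with another pair than `x`. -/
def Network.Stale (net : Network P) (k : Kind) (x : M × ZMod 3) (m : Frame P M) : Prop :=
  net.Carries k m ∧ m.pair ≠ x

theorem Execution.EmitsOnly.not_stale {k : Kind} {x : M × ZMod 3} {s e t : ℕ}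
    (h : R.EmitsOnly k x s e) (hst : s ≤ t) (hte : t < e) (k' : Kind) (y : M × ZMod 3)
    (L : List P) (hy : net.Emits k' y (R.action t) (R.config (t + 1))) :
    ¬ net.Stale k x ⟨net.src k', net.dst k', [], L, y.2, k', y.1⟩ := by
  rintro ⟨⟨-, -, rfl⟩, hne⟩
  exact hne (h t hst hte y hy)

theorem Execution.EmitsOnly.clearBelow (hne : net.sender ≠ net.receiver) {k : Kind}
    {x : M × ZMod 3} {s e : ℕ} (h : R.EmitsOnly k x s e) {W : List P}
    (hW : ∀ y ∈ W, y ∉ net.byzantine) {i : ℕ}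
    (hs : ClearBelow net W (net.Stale k x) i (R.config s)) {t : ℕ} (hst : s ≤ t) (hte : t ≤ e) :
    ClearBelow net W (net.Stale k x) i (R.config t) := by
  induction t, hst using Nat.le_induction with
  | base => exact hs
  | succ t hst ih =>
    exact (ih (by omega)).step hne (R.step t) hW (fun _ _ => Iff.rfl) (h.not_stale hst hte)

theorem Execution.EmitsOnly.clearBeyond (hne : net.sender ≠ net.receiver) {k : Kind}
    {x : M × ZMod 3} {s e : ℕ} (h : R.EmitsOnly k x s e) {W : List P}
    (hW : ∀ y ∈ W, y ∉ net.byzantine) {i : ℕ}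
    (hs : ClearBelow net W (net.Stale k x) i (R.config s)) {u v : P}
    (hu : u ∉ net.byzantine) (hv : v ∉ net.byzantine) {r : ℕ}
    {t t' : ℕ} (hst : s ≤ t) (htt' : t ≤ t') (hte : t' ≤ e)
    (hb : ClearBeyond W (net.Stale k x) i r u v (R.config t)) :
    ClearBeyond W (net.Stale k x) i r u v (R.config t') := by
  induction t', htt' using Nat.le_induction with
  | base => exact hb
  | succ t' htt' ih =>
    exact (ih (by omega)).step hne (R.step t') (fun _ _ => Iff.rfl)
      (h.not_stale (by omega) hte) (h.clearBelow hne hW hs (by omega) (by omega)) hu hv (by omega)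

/-- Every round contains a receipt from the channel, so `q` rounds remove `q` of its oldest
messages. -/
theorem Execution.EmitsOnly.clearBeyond_round {impl : PathSelection} (hnet : net.Admissible impl)
    (hR : R.Fair) {k : Kind} {x : M × ZMod 3} {a e : ℕ}
    (h : R.EmitsOnly k x (R.roundEnd a) e) {W : List P} (hW : ∀ y ∈ W, y ∉ net.byzantine)
    {i : ℕ} (hs : ClearBelow net W (net.Stale k x) i (R.config (R.roundEnd a))) {u v : P}
    (huv : net.graph.Adj u v) (hu : u ∉ net.byzantine) (hv : v ∉ net.byzantine) {r r' q : ℕ}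
    (hrr' : r = r' + q) (hq : R.roundEnd (a + q) ≤ e)
    (hb : ClearBeyond W (net.Stale k x) i r u v (R.config (R.roundEnd a))) :
    ClearBeyond W (net.Stale k x) i r' u v (R.config (R.roundEnd (a + q))) := by
  have hmono := hR.roundEnd_mono hnet
  have hne := hnet.sender_ne_receiver
  induction q generalizing r' with
  | zero => rw [hrr'] at hb; exact hb
  | succ q ih =>
    have h1 : R.roundEnd (a + q) ≤ R.roundEnd (a + (q + 1)) := hmono (by omega)
    have hb' := ih (r' := r' + 1) (by omega) (by omega)
    have hvc := (hnet.existing v u huv.symm).resolve_right hv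
    obtain ⟨t, ht1, ht2, hta⟩ := (hR.covers (a + q) v hvc).2 u huv
    have ht2' : t < R.roundEnd (a + (q + 1)) := ht2
    have h2 : R.roundEnd a ≤ R.roundEnd (a + q) := hmono (by omega)
    have hbt := h.clearBeyond hne hW hs hu hv h2 ht1 (by omega) hb'
    have hbt' := hbt.step hne (R.step t) (fun _ _ => Iff.rfl) (h.not_stale (by omega) (by omega))
      (h.clearBelow hne hW hs (by omega) (by omega)) hu hv (r' := r') (by rw [if_pos hta])
    exact h.clearBeyond hne hW hs hu hv (by omega) ht2' hq hbt'

/-- Each level of the visited length takes `capacity` rounds: once no stale message below level `i`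
is left, those of level `i` are among the at most `capacity` messages now in each channel, and no
new ones arrive behind them. -/
theorem Execution.EmitsOnly.clearBelow_round {impl : PathSelection} (hnet : net.Admissible impl)
    (hR : R.Fair) {k : Kind} {x : M × ZMod 3} {a e : ℕ}
    (h : R.EmitsOnly k x (R.roundEnd a) e) {W : List P} (hW : ∀ y ∈ W, y ∉ net.byzantine)
    {i : ℕ} (hi : R.roundEnd (a + net.capacity * i) ≤ e) :
    ClearBelow net W (net.Stale k x) i (R.config (R.roundEnd (a + net.capacity * i))) := by
  have hmono := hR.roundEnd_mono hnet
  induction i with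
  | zero => exact fun _ _ _ _ _ _ => Nat.zero_le _
  | succ i ih =>
    have h1 : R.roundEnd (a + net.capacity * i) ≤ R.roundEnd (a + net.capacity * (i + 1)) :=
      hmono (by rw [mul_add]; omega)
    have hc := ih (by omega)
    have h2 : R.roundEnd a ≤ R.roundEnd (a + net.capacity * i) := hmono (by omega)
    have h' : R.EmitsOnly k x (R.roundEnd (a + net.capacity * i)) e :=
      fun t ht => h t (h2.trans ht)
    intro u v huv m hm hr
    have hu := hW u hr.left_mem
    have hv := hW v hr.right_mem
    have hb0 : ClearBeyond W (net.Stale k x) i net.capacity u v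
        (R.config (R.roundEnd (a + net.capacity * i))) := by
      intro m' hm'
      have hlen := R.bounded (R.roundEnd (a + net.capacity * i)) u
        ((hnet.existing u v huv).resolve_right hu) v
        ((hnet.existing v u huv.symm).resolve_right hv) huv
      rw [List.drop_eq_nil_of_le hlen] at hm'
      exact absurd hm' (List.not_mem_nil)
    have heq : a + net.capacity * (i + 1) = a + net.capacity * i + net.capacity := by ring
    rw [heq] at hm hi
    have := h'.clearBeyond_round hnet hR hW hc huv hu hv (r' := 0) (q := net.capacity) (by omega)
      hi hb0
    exact this m (by simpa using hm) hr

/-- After enough rounds, no stale messages are left on a route. -/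
theorem Execution.EmitsOnly.not_onRoute {impl : PathSelection} (hnet : net.Admissible impl)
    (hR : R.Fair) {k : Kind} {x : M × ZMod 3} {a e : ℕ}
    (h : R.EmitsOnly k x (R.roundEnd a) e) {W : List P} (hnd : W.Nodup)
    (hW : ∀ y ∈ W, y ∉ net.byzantine) {t : ℕ}
    (ht : R.roundEnd (a + net.capacity * Fintype.card P) ≤ t) (hte : t ≤ e) {u v : P}
    (huv : net.graph.Adj u v) {m : Frame P M} (hm : m ∈ (R.config t).channel u v) :
    ¬ OnRoute W (net.Stale k x) u v m := by
  intro hr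
  have hmono := hR.roundEnd_mono hnet
  have h2 : R.roundEnd a ≤ R.roundEnd (a + net.capacity * Fintype.card P) := hmono (by omega)
  have h' : R.EmitsOnly k x (R.roundEnd (a + net.capacity * Fintype.card P)) e :=
    fun t ht => h t (h2.trans ht)
  have h3 := h'.clearBelow hnet.sender_ne_receiver hW
    (h.clearBelow_round hnet hR hW (i := Fintype.card P) (by omega)) ht hte u v huv m hm hr
  -- A stale message would have visited n nodes by now, but its visited list and two further nodes
  -- fit into a simple route of at most n nodes.
  have h4 := hr.2.length_le
  have h5 := hnd.length_le_card
  simp at h4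
  omega

/-- The condition that in the steps `s, …, e - 1` the origin of the messages of type `k` sends
`x` and nothing else, and that the log for them is filled and not cleared. -/
structure Execution.Steady (R : Execution net M) (k : Kind) (x : M × ZMod 3) (s e : ℕ) :
    Prop where
  outgoing : ∀ t, s ≤ t → t < e → R.action t = .timer (net.src k) →
    (R.config (t + 1)).outgoing k = some x
  keeps : ∀ t, s ≤ t → t < e → net.Keeps k (R.config t) (R.action t)
  accepts : ∀ t, s ≤ t → t < e → (R.config t).Accepts k x.2

theorem Execution.Steady.emitsOnly {k : Kind} {x : M × ZMod 3} {s e : ℕ}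
    (h : R.Steady k x s e) : R.EmitsOnly k x s e := by
  intro t hs he y hy
  have := h.outgoing t hs he hy.1
  rw [hy.2] at this
  exact Option.some.inj this

theorem Execution.Steady.mono {k : Kind} {x : M × ZMod 3} {s e s' e' : ℕ}
    (h : R.Steady k x s e) (hs : s ≤ s') (he : e' ≤ e) : R.Steady k x s' e' :=
  ⟨fun t h1 h2 => h.outgoing t (hs.trans h1) (h2.trans_le he),
    fun t h1 h2 => h.keeps t (hs.trans h1) (h2.trans_le he),
    fun t h1 h2 => h.accepts t (hs.trans h1) (h2.trans_le he)⟩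

/-- A path on which the messages of type `k` are sent and that has only correct nodes; `Q` is
its list of relays, which starts in the origin. -/
structure Network.CorrectRoute (net : Network P) (k : Kind) (Q : List P) : Prop where
  isPath : IsPath net.graph (net.src k) (net.dst k) (Q ++ [net.dst k])
  not_byzantine : ∀ y ∈ Q ++ [net.dst k], y ∉ net.byzantine
  mem_paths : Q ++ [net.dst k] ∈ net.paths (net.src k) (net.dst k)

/-- The messages with pair `x` that travel along `Q`, and the entries in its log. -/
noncomputable def Execution.progress (R : Execution net M) (k : Kind) (x : M × ZMod 3)
    (Q : List P) (t : ℕ) : ℕ :=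
  load net (Q ++ [net.dst k])
    (fun m => net.Carries k m ∧ m.pair = x ∧ m.intended = Q ++ [net.dst k])
    (R.config t).channel + ((R.config t).log k Q).length

theorem Execution.Steady.progress_succ (hne : net.sender ≠ net.receiver) {k : Kind}
    {x : M × ZMod 3} {s e t : ℕ} (h : R.Steady k x s e) (hs : s ≤ t) (he : t < e) {Q : List P}
    (hQ : net.CorrectRoute k Q) :
    R.progress k x Q t + (if R.action t = .timer (net.src k) then 1 else 0) ≤
      R.progress k x Q (t + 1) :=
  (R.step t).throughput hne rfl hQ.isPath hQ.not_byzantine hQ.mem_paths (h.outgoing t hs he)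
    (h.keeps t hs he) (h.accepts t hs he)

theorem Execution.Steady.progress_mono (hne : net.sender ≠ net.receiver) {k : Kind}
    {x : M × ZMod 3} {s e t t' : ℕ} (h : R.Steady k x s e) (hs : s ≤ t) (htt' : t ≤ t')
    (he : t' ≤ e) {Q : List P} (hQ : net.CorrectRoute k Q) :
    R.progress k x Q t ≤ R.progress k x Q t' := by
  induction t', htt' using Nat.le_induction with
  | base => exact le_rfl
  | succ t' htt' ih =>
    have h1 := h.progress_succ hne (by omega) he hQ
    have h2 := ih (by omega)
    omega

theorem Execution.Steady.progress_round {impl : PathSelection} (hnet : net.Admissible impl)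
    (hR : R.Fair) {k : Kind} {x : M × ZMod 3} {a n e : ℕ}
    (h : R.Steady k x (R.roundEnd a) e) (he : R.roundEnd (a + n) ≤ e) {Q : List P}
    (hQ : net.CorrectRoute k Q) :
    R.progress k x Q (R.roundEnd a) + n ≤ R.progress k x Q (R.roundEnd (a + n)) := by
  have hmono := hR.roundEnd_mono hnet
  have hne := hnet.sender_ne_receiver
  induction n with
  | zero => exact le_rfl
  | succ n ih =>
    have h1 : R.roundEnd (a + n) ≤ R.roundEnd (a + (n + 1)) := hmono (by omega)
    have h2 : R.roundEnd a ≤ R.roundEnd (a + n) := hmono (by omega)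
    obtain ⟨t, ht1, ht2, hta⟩ := hR.exists_timer (hnet.src_correct k) (a + n)
    have ht2' : t < R.roundEnd (a + (n + 1)) := ht2
    have h3 := ih (by omega)
    have h4 := h.progress_mono hne h2 ht1 (by omega) hQ
    have h5 := h.progress_succ hne (by omega : R.roundEnd a ≤ t) (by omega) hQ
    rw [if_pos hta] at h5
    have h6 := h.progress_mono hne (by omega : R.roundEnd a ≤ t + 1) ht2' he hQ
    omega

/-- The origin adds a message to the route in every round, and all but the at most C messages still
in transit have reached the log. -/
theorem Execution.Steady.length_log_round {impl : PathSelection} (hnet : net.Admissible impl)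
    (hR : R.Fair) {k : Kind} {x : M × ZMod 3} {a n e : ℕ}
    (h : R.Steady k x (R.roundEnd a) e) (he : R.roundEnd (a + n) ≤ e) {Q : List P}
    (hQ : net.CorrectRoute k Q) :
    ((R.config (R.roundEnd a)).log k Q).length + n ≤
      ((R.config (R.roundEnd (a + n))).log k Q).length + net.capacity * Fintype.card P := by
  have h1 := h.progress_round hnet hR he hQ
  have h2 := load_le (g := fun m => net.Carries k m ∧ m.pair = x ∧ m.intended = Q ++ [net.dst k])
    hnet hQ.isPath.1 hQ.not_byzantine (R.bounded (R.roundEnd (a + n)))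
  unfold progress at h1
  omega

/-- A timer step of the sender puts a message on a correct route, so the bound on the load of a
route is positive. This allows additive constants to be absorbed into multiples of C. -/
theorem Network.Admissible.one_le {impl : PathSelection} (hnet : net.Admissible impl)
    (hR : R.Fair) : 1 ≤ net.capacity * Fintype.card P := by
  obtain ⟨D, hD, hdis, hc⟩ := hnet.exists_correct_paths hnet.sender_correct
    hnet.receiver_correct hnet.sender_ne_receiver
  obtain ⟨l, hl⟩ : D.Nonempty := Finset.card_pos.1 (by rw [hdis.1]; exact Nat.succ_pos _)
  have hp := hdis.2.1 l hl
  obtain ⟨w, l', hWl⟩ := hp.exists_eq_cons_cons hnet.sender_ne_receiver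
  have hnext : nextHop net.sender l = some w := by
    rw [hWl]
    exact nextHop_eq_some (A := []) (by rw [List.nil_append, ← hWl]; exact hp.1)
  have hadj : net.graph.Adj net.sender w := by
    have := hp.2.1
    rw [hWl, List.isChain_cons_cons] at this
    exact this.1
  obtain ⟨t, -, -, ht⟩ := hR.exists_timer hnet.sender_correct 0
  have hs := R.step t
  rw [ht] at hs
  obtain ⟨y, hy⟩ := hs.timer_eq
  have h1 := timerStep_channel hnet.sender_ne_receiver .data y (R.config t)
  simp only [Config.outgoing, Network.src] at h1
  rw [← hy] at h1
  have h2 := load_le (g := fun _ => True) hnet hp.1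
    (fun z hz => hnet.not_byzantine (hc l hl z hz)) (R.bounded (t + 1))
  refine le_trans ?_ h2
  rw [h1]
  refine le_trans (Nat.le_add_left _ _) (load_lt_load_faultTolerantSend (hD hl) hnext hadj
    ⟨trivial, l', ?_⟩)
  rw [hWl]
  rfl

/-- When no stale messages are left on a route, its log only gets new entries `x`. -/
theorem Execution.Steady.log_succ {k : Kind}
    {x : M × ZMod 3} {s e t : ℕ} (h : R.Steady k x s e) (hs : s ≤ t) (he : t < e) {Q : List P}
    (hfresh : ∀ u v, net.graph.Adj u v → ∀ m ∈ (R.config t).channel u v,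
      ¬ OnRoute (Q ++ [net.dst k]) (net.Stale k x) u v m) :
    (R.config (t + 1)).log k Q = (R.config t).log k Q ∨
      (R.config (t + 1)).log k Q = x :: (R.config t).log k Q ∧
      (net.Supported k ((R.config (t + 1)).log k) x → R.SupportsAt k t x) := by
  rcases (R.step t).log_cases (h.keeps t hs he) with h1 | ⟨j, m, rest, ha, hadj, hch, hm, h1⟩
  · exact .inl (congrFun h1 Q)
  · by_cases hQ : Q = m.visited ++ [j]
    · have hx : m.pair = x := by
        by_contra hx
        refine hfresh j _ hadj m (by simp [hch]) ⟨⟨hm, hx⟩, ?_⟩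
        rw [hQ]
        simp
      have hacc : (R.config t).Accepts k (m.hop j).label := by
        have h2 := h.accepts t hs he
        rw [← hx] at h2
        exact h2
      right
      refine ⟨?_, fun hsup => ⟨j, m, rest, ha, hadj, hch, hm, hx, h1 ▸ hsup⟩⟩
      rw [h1, Config.logWith, if_pos hacc, enqueue,
        if_pos (show Q = (m.hop j).visited from hQ), ← hx]
      rfl
    · left
      rw [h1]
      unfold Config.logWith enqueue
      split_ifs with h2
      · exact if_neg hQ
      · rfl

theorem floodedPath_replicate_append {x : M × ZMod 3} {n : ℕ} {q : List (M × ZMod 3)}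
    (hn : net.capacity * Fintype.card P + 1 ≤ n) :
    net.FloodedPath (List.replicate n x ++ q) x := by
  unfold Network.FloodedPath
  rw [List.take_append_of_le_length (by simpa using hn), List.take_replicate,
    min_eq_left hn]

/-- If `x` is sent for long enough, and its log is not cleared, then `x` is supported when it
is received. -/
theorem Execution.Steady.exists_supportsAt {impl : PathSelection} (hnet : net.Admissible impl)
    (hR : R.Fair) {k : Kind} {x : M × ZMod 3} {a e : ℕ}
    (h : R.Steady k x (R.roundEnd a) e)
    (he : R.roundEnd (a + (4 * (net.capacity * Fintype.card P) + 2)) ≤ e) :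
    ∃ t, R.roundEnd a ≤ t ∧ t < R.roundEnd (a + (4 * (net.capacity * Fintype.card P) + 2)) ∧
      R.SupportsAt k t x := by
  have hmono := hR.roundEnd_mono hnet
  set C := net.capacity * Fintype.card P with hC
  obtain ⟨D, hD, hdis, hDc⟩ := hnet.exists_correct_paths (hnet.src_correct k)
    (hnet.dst_correct k) (src_ne_dst hnet.sender_ne_receiver k)
  have hroute : ∀ l ∈ D, ∃ Q, l = Q ++ [net.dst k] ∧ net.CorrectRoute k Q := by
    intro l hl
    obtain ⟨Q, rfl⟩ := (hdis.2.1 l hl).exists_eq_concat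
    exact ⟨Q, rfl, hdis.2.1 _ hl, fun y hy => hnet.not_byzantine (hDc _ hl y hy), hD hl⟩
  have hr1 : R.roundEnd a ≤ R.roundEnd (a + C) := hmono (by omega)
  have hr2 : R.roundEnd (a + C) ≤ R.roundEnd (a + C + (2 * C + 1)) := hmono (by omega)
  have hr3 : R.roundEnd (a + C + (2 * C + 1)) ≤ R.roundEnd (a + C + (2 * C + 1) + (C + 1)) :=
    hmono (by omega)
  -- C rounds flush the stale messages, 2C + 1 rounds bring C + 1 new entries `x` despite C messages
  -- in transit, and C + 1 rounds enforce one more receipt, at which support is tested.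
  have hend : a + C + (2 * C + 1) + (C + 1) = a + (4 * C + 2) := by omega
  rw [← hend] at he ⊢
  generalize hT1 : R.roundEnd (a + C + (2 * C + 1)) = T1 at hr2 hr3
  generalize hT2 : R.roundEnd (a + C + (2 * C + 1) + (C + 1)) = T2 at he hr3 ⊢
  have hfresh : ∀ Q, net.CorrectRoute k Q → ∀ t, R.roundEnd (a + C) ≤ t → t ≤ e →
      ∀ u v, net.graph.Adj u v → ∀ m ∈ (R.config t).channel u v,
      ¬ OnRoute (Q ++ [net.dst k]) (net.Stale k x) u v m :=
    fun Q hQ t ht hte u v huv m hm =>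
      h.emitsOnly.not_onRoute hnet hR hQ.isPath.1 hQ.not_byzantine ht hte huv hm
  have hlog : ∀ Q, net.CorrectRoute k Q → ∀ t, R.roundEnd (a + C) ≤ t → t ≤ e → ∃ n,
      (R.config t).log k Q = List.replicate n x ++ (R.config (R.roundEnd (a + C))).log k Q := by
    intro Q hQ t ht
    induction t, ht using Nat.le_induction with
    | base => exact fun _ => ⟨0, rfl⟩
    | succ t ht ih =>
      intro hte
      obtain ⟨n, hn⟩ := ih (by omega)
      rcases h.log_succ (by omega) hte (hfresh Q hQ t ht (by omega)) with h1 | ⟨h1, -⟩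
      · exact ⟨n, by rw [h1, hn]⟩
      · exact ⟨n + 1, by rw [h1, hn]; rfl⟩
  have hlen : ∀ Q, net.CorrectRoute k Q → ∀ t, T1 ≤ t → t ≤ e →
      ((R.config T1).log k Q).length ≤ ((R.config t).log k Q).length := by
    intro Q hQ t ht
    induction t, ht using Nat.le_induction with
    | base => exact fun _ => le_rfl
    | succ t ht ih =>
      intro hte
      have h0 := ih (by omega)
      rcases h.log_succ (by omega) hte (hfresh Q hQ t (by omega) (by omega)) with h1 | ⟨h1, -⟩
      · rwa [h1]
      · rw [h1, List.length_cons]; omega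
  -- After the flush only `x` is logged for `Q`, so growth in length by C + 1 amounts to C + 1
  -- copies of `x` on top.
  have hflood : ∀ Q, net.CorrectRoute k Q → ∀ t, T1 ≤ t → t ≤ e →
      net.FloodedPath ((R.config t).log k Q) x := by
    intro Q hQ t ht hte
    obtain ⟨n, hn⟩ := hlog Q hQ t (by omega) hte
    rw [hn]
    refine floodedPath_replicate_append ?_
    have h1 := (h.mono hr1 le_rfl).length_log_round hnet hR (n := 2 * C + 1) (by omega) hQ
    rw [hT1] at h1
    have h2 := hlen Q hQ t ht hte
    rw [hn, List.length_append, List.length_replicate] at h2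
    omega
  have hsup : ∀ t, T1 ≤ t → t ≤ e → net.Supported k ((R.config t).log k) x := by
    intro t ht hte
    refine ⟨D, fun l hl => ?_, hdis.mono fun _ _ _ _ _ _ hadj => hadj.ne⟩
    obtain ⟨Q, hlQ, hQ⟩ := hroute l hl
    exact ⟨Q, hflood Q hQ t ht hte, hlQ⟩
  obtain ⟨l, hl⟩ : D.Nonempty := Finset.card_pos.1 (by rw [hdis.1]; exact Nat.succ_pos _)
  obtain ⟨Q, -, hQ⟩ := hroute l hl
  by_contra hno
  push Not at hno
  -- From `T1` on all the correct routes are flooded with `x`, so any new entry for `Q` would be a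
  -- receipt at which `x` is supported. If there is none, this log stands still, against the growth
  -- enforced by C + 1 rounds.
  have hconst : ∀ t, T1 ≤ t → t ≤ T2 → (R.config t).log k Q = (R.config T1).log k Q := by
    intro t ht
    induction t, ht using Nat.le_induction with
    | base => exact fun _ => rfl
    | succ t ht ih =>
      intro hte
      rcases h.log_succ (by omega) (by omega) (hfresh Q hQ t (by omega) (by omega)) with
        h1 | ⟨-, h1⟩
      · rw [h1, ih (by omega)]
      · exact absurd (h1 (hsup (t + 1) (by omega) (by omega))) (hno t (by omega) hte)
  have h1 := (h.mono (by omega : R.roundEnd a ≤ T1) le_rfl)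
  rw [← hT1] at h1
  have h2 := h1.length_log_round hnet hR (n := C + 1) (by omega) hQ
  rw [hT1, hT2, hconst T2 hr3 le_rfl] at h2
  omega

end Rounds

/-! ### Infinitely many fetches, at linear distance. -/

section Liveness

variable {P M : Type*} [Fintype P] {net : Network P} {R : Execution net M}

/-- The sender fetches a message within a linear number of rounds. -/
theorem Execution.Fair.exists_fetchesAt {impl : PathSelection} (hnet : net.Admissible impl)
    (hR : R.Fair) (a : ℕ) :
    ∃ t, R.roundEnd a ≤ t ∧ t < R.roundEnd (a + 19 * (net.capacity * Fintype.card P)) ∧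
      R.FetchesAt t := by
  have hmono := hR.roundEnd_mono hnet
  have hC1 := hnet.one_le hR
  set C := net.capacity * Fintype.card P with hC
  set S := 4 * C + 2 with hS
  by_contra hno
  push Not at hno
  -- Three periods of 4C + 2 rounds and one more round make 12C + 7 rounds, which is at most 19C
  -- because C is positive.
  have hE : R.roundEnd (a + S + S + S + 1) ≤ R.roundEnd (a + 19 * C) := hmono (by omega)
  have h01 : R.roundEnd a ≤ R.roundEnd (a + S) := hmono (by omega)
  have h12 : R.roundEnd (a + S) ≤ R.roundEnd (a + S + S) := hmono (by omega)
  have h23 : R.roundEnd (a + S + S) ≤ R.roundEnd (a + S + S + S) := hmono (by omega)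
  have h34 : R.roundEnd (a + S + S + S) ≤ R.roundEnd (a + S + S + S + 1) := hmono (by omega)
  generalize R.roundEnd (a + 19 * C) = E at hE hno
  obtain ⟨x, hx⟩ : ∃ x, x = (R.config (R.roundEnd a)).pair := ⟨_, rfl⟩
  have hpair : ∀ t, R.roundEnd a ≤ t → t ≤ E → (R.config t).pair = x := by
    intro t h1 h2
    rw [hx]
    exact pair_eq h1 (fetchesBefore_eq_of_not h1 fun u h3 h4 =>
      hno u h3 (h4.trans_le h2)).symm
  -- Steadiness for data includes that nothing becomes supported, as support clears the log. If
  -- nothing were supported in the period, the sender's persistent pair would be, a contradiction.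
  -- The pair obtained may be a stale one.
  have hdata : ∀ b, R.roundEnd a ≤ R.roundEnd b → R.roundEnd (b + S) ≤ E →
      ∃ t, R.roundEnd b ≤ t ∧ t < R.roundEnd (b + S) ∧ ∃ y, R.SupportsAt .data t y := by
    intro b hb hbE
    by_contra hns
    push Not at hns
    have hst : R.Steady .data x (R.roundEnd b) (R.roundEnd (b + S)) :=
      ⟨fun t h1 h2 _ => congrArg some (hpair (t + 1) (by omega) (by omega)),
        fun t h1 h2 => hns t h1 h2, fun _ _ _ => trivial⟩
    obtain ⟨t, h1, h2, h3⟩ := hst.exists_supportsAt hnet hR le_rfl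
    exact hns t h1 h2 x h3
  obtain ⟨t₁, ht₁, ht₁', y₁, hy₁⟩ := hdata a le_rfl (by omega)
  obtain ⟨t₂, ht₂, ht₂', y₂, hy₂⟩ := hdata (a + S) h01 (by omega)
  have hlog : (R.config (t₁ + 1)).log .data = fun _ => [] := by
    simp only [Config.log, hy₁.rcv_eq]
  -- The first supported pair is arbitrary but empties the log. Whatever is supported later has been
  -- sent since then and is the sender's pair; hence a second period is needed.
  have honly : ∀ t, t₁ < t → t ≤ E → ∀ y, R.SupportsAt .data t y → y = x := by
    intro t h1 h2 y hy
    obtain ⟨u, h3, h4, h5⟩ := hy.exists_emitsAt hnet h1 hlog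
    rw [emitsAt_data h5]
    exact hpair (u + 1) (by omega) (by omega)
  have hack : ∀ t, t₂ + 1 ≤ t → t ≤ E → (R.config t).rcv.acking = some x := by
    intro t ht
    induction t, ht using Nat.le_induction with
    | base =>
      intro h1
      rw [hy₂.rcv_eq, honly t₂ (by omega) (by omega) y₂ hy₂]
    | succ t ht ih =>
      intro h1
      rcases rcv_cases (R := R) t with ⟨y, hy⟩ | h2
      · rw [hy.rcv_eq, honly t (by omega) (by omega) y hy]
      · rw [h2.2.1]
        exact ih (by omega)
  have hst : R.Steady .ack x (R.roundEnd (a + S + S)) (R.roundEnd (a + S + S + S)) :=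
    ⟨fun t h1 h2 _ => hack (t + 1) (by omega) (by omega),
      fun t h1 h2 => hno t (by omega) (by omega),
      fun t h1 h2 => congrArg Prod.snd (hpair t (by omega) (by omega))⟩
  obtain ⟨t₃, ht₃, ht₃', h₃⟩ := hst.exists_supportsAt hnet hR le_rfl
  have ht₃'' : t₃ < R.roundEnd (a + S + S + S) := ht₃'
  obtain ⟨t₄, ht₄, ht₄', h₄⟩ := hR.exists_timer hnet.sender_correct (a + S + S + S)
  have happ := approved_of_not_fetchesAt (by omega : t₃ + 1 ≤ t₄)
    ((R.step t₃).approved_of_supports h₃) fun u h1 h2 => hno u (by omega) (by omega)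
  exact hno t₄ (by omega) (by omega) ⟨h₄, happ⟩

theorem Execution.Fair.le_fetchesBefore {impl : PathSelection} (hnet : net.Admissible impl)
    (hR : R.Fair) (k : ℕ) :
    k ≤ R.fetchesBefore (R.roundEnd (19 * k * (net.capacity * Fintype.card P))) := by
  induction k with
  | zero => exact Nat.zero_le _
  | succ k ih =>
    obtain ⟨t, h1, h2, h3⟩ := hR.exists_fetchesAt hnet
      (19 * k * (net.capacity * Fintype.card P))
    have h4 : 19 * (k + 1) * (net.capacity * Fintype.card P) =
      19 * k * (net.capacity * Fintype.card P) + 19 * (net.capacity * Fintype.card P) := by ring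
    rw [h4]
    have h5 := h3.count_succ
    have h6 := fetchesBefore_mono (R := R) h1
    have h7 := fetchesBefore_mono (R := R) h2
    simp only [Nat.succ_eq_add_one] at h7
    omega

theorem Execution.Fair.exists_fetchesAt_ge {impl : PathSelection} (hnet : net.Admissible impl)
    (hR : R.Fair) (t : ℕ) : ∃ t' ≥ t, R.FetchesAt t' := by
  have hmono : StrictMono R.roundEnd := strictMono_nat_of_lt_succ fun k => by
    obtain ⟨t, h1, h2, -⟩ := hR.exists_timer hnet.sender_correct k
    omega
  obtain ⟨u, h1, -, h2⟩ := hR.exists_fetchesAt hnet t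
  -- Every round contains at least one step, so round `t` does not begin before time `t`.
  exact ⟨u, (hmono.le_apply).trans h1, h2⟩

theorem Execution.exists_fetchesAt_of_lt {n t : ℕ} (h : n < R.fetchesBefore t) :
    ∃ u < t, R.FetchesAt u ∧ R.fetchesBefore u = n := by
  induction t with
  | zero => simp [fetchesBefore] at h
  | succ t ih =>
    by_cases hn : n < R.fetchesBefore t
    · obtain ⟨u, h1, h2⟩ := ih hn
      exact ⟨u, h1.trans (Nat.lt_succ_self t), h2⟩
    · by_cases ht : R.FetchesAt t
      · rw [ht.count_succ] at h
        exact ⟨t, Nat.lt_succ_self t, ht, by omega⟩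
      · rw [count_succ_of_not ht] at h
        exact absurd h hn

end Liveness

/-! ### Gluing executions, and safety of the configuration. -/

section Splice

variable {P M : Type*} [Fintype P] {net : Network P}

/-- The execution that proceeds as `R` until time `T` and then as `R'`. -/
noncomputable def Execution.splice (R R' : Execution net M) (T : ℕ)
    (h : R'.config 0 = R.config T) : Execution net M where
  config t := if t < T then R.config t else R'.config (t - T)
  action t := if t < T then R.action t else R'.action (t - T)
  step t := by
    rcases lt_trichotomy (t + 1) T with h1 | h1 | h1
    · simp only [h1, (Nat.lt_succ_self t).trans h1, if_true]
      exact R.step t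
    · subst h1
      simp only [lt_irrefl, Nat.lt_succ_self, if_true, if_false, Nat.sub_self, h]
      exact R.step t
    · rw [if_neg (by omega), if_neg (by omega), if_neg (by omega),
        show t + 1 - T = t - T + 1 by omega]
      exact R'.step (t - T)
  bounded t := by
    split_ifs
    exacts [R.bounded t, R'.bounded (t - T)]

variable {R R' : Execution net M} {T : ℕ} {h : R'.config 0 = R.config T}

theorem Execution.splice_config_add (t : ℕ) :
    (R.splice R' T h).config (T + t) = R'.config t := by
  simp [splice]

theorem Execution.splice_action_add (t : ℕ) :
    (R.splice R' T h).action (T + t) = R'.action t := by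
  simp [splice]

theorem Execution.splice_config_of_le {t : ℕ} (ht : t ≤ T) :
    (R.splice R' T h).config t = R.config t := by
  rcases ht.lt_or_eq with ht | rfl
  · simp [splice, ht]
  · simp [splice, h]

theorem Execution.splice_fetchesAt_add (t : ℕ) :
    (R.splice R' T h).FetchesAt (T + t) ↔ R'.FetchesAt t := by
  unfold FetchesAt
  rw [splice_config_add, splice_action_add]

theorem Execution.splice_fetchesAt_of_lt {t : ℕ} (ht : t < T) :
    (R.splice R' T h).FetchesAt t ↔ R.FetchesAt t := by
  unfold FetchesAt
  rw [splice_config_of_le ht.le]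
  simp [splice, ht]

theorem Execution.splice_fetchesBefore_of_le {t : ℕ} (ht : t ≤ T) :
    (R.splice R' T h).fetchesBefore t = R.fetchesBefore t := by
  induction t with
  | zero => simp [fetchesBefore]
  | succ t ih =>
    by_cases h1 : R.FetchesAt t
    · rw [h1.count_succ, ((splice_fetchesAt_of_lt ht).2 h1).count_succ, ih (by omega)]
    · rw [count_succ_of_not h1, count_succ_of_not (mt (splice_fetchesAt_of_lt ht).1 h1),
        ih (by omega)]

theorem Execution.splice_fetchesBefore_add (t : ℕ) :
    (R.splice R' T h).fetchesBefore (T + t) = R.fetchesBefore T + R'.fetchesBefore t := by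
  induction t with
  | zero =>
    rw [add_zero, splice_fetchesBefore_of_le le_rfl]
    simp [fetchesBefore]
  | succ t ih =>
    rw [← add_assoc]
    by_cases h1 : R'.FetchesAt t
    · rw [h1.count_succ, ((splice_fetchesAt_add t).2 h1).count_succ, ih, add_assoc]
    · rw [count_succ_of_not h1, count_succ_of_not (mt (splice_fetchesAt_add t).1 h1), ih]

theorem Execution.splice_deliversAt_add (t : ℕ) (m : M) :
    (R.splice R' T h).DeliversAt (T + t) m ↔ R'.DeliversAt t m := by
  unfold DeliversAt
  rw [add_assoc, splice_config_add, splice_config_add]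

theorem Execution.splice_sendsAt_add (t : ℕ) (m : M) :
    (R.splice R' T h).SendsAt (T + t) m ↔ R'.SendsAt t m := by
  unfold SendsAt
  rw [add_assoc, splice_config_add, splice_action_add]

theorem Execution.Synced.splice {d : ℕ} (hs : R.Synced d T) : (R.splice R' T h).Synced d T := by
  obtain ⟨s, hs, h1, h2, h3, h4⟩ := hs
  refine ⟨s, hs, ?_⟩
  rw [splice_config_of_le hs, splice_config_of_le le_rfl, splice_fetchesBefore_of_le hs,
    splice_fetchesBefore_of_le le_rfl]
  exact ⟨h1, h2, h3, h4⟩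

/-- The configuration before a fetch is safe when the receiver has caught up. -/
theorem Execution.Synced.safe {impl : PathSelection} (hnet : net.Admissible impl)
    (hs : R.Synced 0 T) (happ : (R.config T).snd.approved = true) : net.Safe (R.config T) := by
  intro R' h hR'
  -- Synchronization is witnessed by an earlier time, which an execution starting in this
  -- configuration lacks; the glued execution provides it.
  have hS : (R.splice R' T h).Synced 0 T := hs.splice
  -- Fetch counts in the two executions differ by the constant number of fetches before `T`, so
  -- correspondence of steps is the same in both.
  have hF : ∀ t t', (R.splice R' T h).fetchesBefore (T + t + 1) =
      (R.splice R' T h).fetchesBefore (T + t' + 1) ↔ R'.fetchCount t = R'.fetchCount t' := by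
    intro t t'
    rw [fetchCount_eq, fetchCount_eq, add_assoc, add_assoc, splice_fetchesBefore_add,
      splice_fetchesBefore_add, add_right_inj]
  have honce : ∀ t t' m m', R'.DeliversAt t m → R'.DeliversAt t' m' →
      R'.fetchCount t = R'.fetchCount t' → ¬ t < t' := by
    intro t t' m m' hd hd' he hlt
    exact hS.delivers_once hnet (Nat.le_add_right T t) (Nat.add_lt_add_left hlt T)
      ((splice_deliversAt_add t m).2 hd) ((splice_deliversAt_add t' m').2 hd') ((hF t t').2 he)
  refine ⟨fun t m hm => ?_, fun t' m hd => ?_, fun t t' m m' hd hd' he => ?_⟩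
  · obtain ⟨t', h1, h2, h3⟩ := hS.exists_deliversAt_of_sendsAt hnet
      (by rw [splice_config_of_le le_rfl]; exact happ)
      (fun u => by
        obtain ⟨v, hv, hv'⟩ := hR'.exists_fetchesAt_ge hnet u
        exact ⟨T + v, by omega, (splice_fetchesAt_add v).2 hv'⟩)
      (Nat.le_add_right T t) ((splice_sendsAt_add t m).2 hm)
    obtain ⟨t', rfl⟩ := Nat.exists_eq_add_of_le h1
    exact ⟨t', (splice_deliversAt_add t' m).1 h2, (hF t' t).1 h3⟩
  · obtain ⟨-, u, h1, h2, h3, h4⟩ := hS.of_deliversAt hnet (Nat.le_add_right T t')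
      ((splice_deliversAt_add t' m).2 hd)
    obtain ⟨u, rfl⟩ := Nat.exists_eq_add_of_le h1
    exact ⟨u, by omega, (splice_sendsAt_add u m).1 h3, (hF u t').1 h4⟩
  · rcases lt_trichotomy t t' with hlt | rfl | hlt
    · exact absurd hlt (honce t t' m m' hd hd' he)
    · rfl
    · exact absurd hlt (honce t' t m' m hd' hd he.symm)

end Splice

end EndToEnd

/-! ### The theorem. -/

theorem mainTheorem2 :
    ∃ K : ℕ, ∀ (P : Type*) [Fintype P] (M : Type*) (net : EndToEnd.Network P)
      (impl : EndToEnd.PathSelection), net.Admissible impl →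
      ∀ R : EndToEnd.Execution net M, R.Fair →
        ∃ t ≤ R.roundEnd (K * (net.capacity * Fintype.card P)),
          R.FetchesAt t ∧ R.fetchCount t = 4 ∧ net.Safe (R.config t) := by
  -- Four fetches at 19C rounds each.
  refine ⟨76, fun P _ M net impl hnet R hR => ?_⟩
  -- Exactly three fetches precede `t₄`; they supply the three complete intervals that
  -- synchronization requires.
  obtain ⟨t₄, h₄, hf₄, hc₄⟩ := EndToEnd.Execution.exists_fetchesAt_of_lt
    (show 3 < _ from hR.le_fetchesBefore hnet 4)
  obtain ⟨t₃, h₃, hf₃, hc₃⟩ := EndToEnd.Execution.exists_fetchesAt_of_lt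
    (show 2 < R.fetchesBefore t₄ by omega)
  obtain ⟨t₂, h₂, hf₂, hc₂⟩ := EndToEnd.Execution.exists_fetchesAt_of_lt
    (show 1 < R.fetchesBefore t₃ by omega)
  obtain ⟨t₁, h₁, hf₁, hc₁⟩ := EndToEnd.Execution.exists_fetchesAt_of_lt
    (show 0 < R.fetchesBefore t₂ by omega)
  refine ⟨t₄, h₄.le, hf₄, ?_, ?_⟩
  · rw [EndToEnd.Execution.fetchCount_eq, hf₄.count_succ, hc₄]
  · exact (EndToEnd.Execution.synced_of_fetches hnet hf₁ hf₂ hf₃ hf₄ h₁ h₂ h₃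
      (by rw [hf₁.count_succ]; omega) (by rw [hf₂.count_succ]; omega)
      (by rw [hf₃.count_succ]; omega)).safe hnet hf₄.2
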